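/- Let $q$ be a prime power, let $m\ge 4$, and let $V$ be an $m$-dimensional vector space over $\mathbb F_{q^2}$ equipped with a non-degenerate Hermitian form $\eta$ (with respect to the involution $x\mapsto x^q$). Let $\mathbb H_{m,2}$ be the set of points $[v_1\wedge v_2]$ of $\mathrm{PG}(\bigwedge^2 V)$, where $\langle v_1,v_2\rangle$ ranges over the totally $\eta$-isotropic $2$-dimensional subspaces of $V$ (the totally isotropic lines of $\mathrm{PG}(V)$). Choose vector representatives $\omega_1,\dots,\omega_N$ of the points of $\mathbb H_{m,2}$, one for each point, in any order. The line Hermitian Grassmann code $$\mathcal C(\mathbb H_{m,2})=\{(\varphi(\omega_1),\dots,\varphi(\omega_N)) : \varphi\in(\textstyle\bigwedge^2V)^*\}\subseteq\mathbb F_{q^2}^N$$ is an $[N,K,d_{\min}]$-linear code over $\mathbb F_{q^2}$, where $N$ is the number of totally $\eta$-isotropic lines of $\mathrm{PG}(V)$, $$N=\frac{(q^m+(-1)^{m-1})(q^{m-1}-(-1)^{m-1})(q^{m-2}+(-1)^{m-3})(q^{m-3}-(-1)^{m-3})}{(q^2-1)^2(q^2+1)},\qquad K=\binom m2,$$ and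 $$d_{\min}=\begin{cases} q^{4m-12}-q^{2m-6} & \text{if } m=4 \text{ or } m=6,\\ q^{4m-12} & \text{if } m\ge 8 \text{ is even},\\ q^{4m-12}-q^{3m-9} & \text{if } m \text{ is odd.}\end{cases}$$ -/

import Mathlib

open Module
open scoped LinearAlgebra.Projectivization

namespace HermitianGrassmann

section Pluecker

variable {F V : Type*} [Field F] [AddCommGroup V] [Module F V] [FiniteDimensional F V]

/-- The image of `⋀^k X` in `⋀^k V` is one-dimensional when `dim X = k`. -/
theorem finrank_range_map_subtype {k : ℕ} (X : Submodule F V) (hX : finrank F X = k) :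
    finrank F (LinearMap.range (exteriorPower.map k X.subtype)) = 1 := by
  rw [LinearMap.finrank_range_of_inj
    (exteriorPower.map_injective_field (Submodule.subtype_injective X)),
    exteriorPower.finrank_eq, hX, Nat.choose_self]

/-- The Plücker embedding `e_k`: it sends a `k`-dimensional subspace `X = ⟨v₁, …, v_k⟩` of `V` to
the point `[v₁ ∧ ⋯ ∧ v_k]` of `PG(⋀^k V)`, which is the line `⋀^k X ⊆ ⋀^k V`. -/
noncomputable def pluecker (k : ℕ) (X : {X : Submodule F V // finrank F X = k}) :
    ℙ F (⋀[F]^k V) :=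
  Projectivization.mk'' (LinearMap.range (exteriorPower.map k X.1.subtype))
    (finrank_range_map_subtype X.1 X.2)

/-- For every basis `b` of `X`, the Plücker point of `X` is spanned by `b₁ ∧ ⋯ ∧ b_k`. -/
theorem pluecker_submodule (k : ℕ) (X : {X : Submodule F V // finrank F X = k})
    (b : Basis (Fin k) F X.1) :
    (pluecker k X).submodule =
      Submodule.span F {exteriorPower.ιMulti F k (fun i => (b i : V))} := by
  have h0 : exteriorPower.ιMulti F k b ≠ 0 := fun h => by
    have h1 := exteriorPower.alternatingMapLinearEquiv_apply_ιMulti b.det b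
    rw [h, map_zero, b.det_self] at h1
    exact zero_ne_one h1
  have h1 : finrank F (⋀[F]^k X.1) = 1 := by
    rw [exteriorPower.finrank_eq, X.2, Nat.choose_self]
  rw [pluecker, Projectivization.submodule_mk'', LinearMap.range_eq_map,
    ← (finrank_eq_one_iff_of_nonzero _ h0).1 h1, Submodule.map_span, Set.image_singleton,
    exteriorPower.map_apply_ιMulti]
  rfl

end Pluecker

section Hermitian

variable {F V : Type*} [Field F] [AddCommGroup V] [Module F V] [FiniteDimensional F V]
variable {σ : F →+* F}

/-- The points of the line Hermitian Grassmannian: the totally `η`-isotropic lines of `PG(V)`,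
that is, the `2`-dimensional subspaces of `V` on which `η` vanishes identically. -/
def isotropicLines (η : V →ₛₗ[σ] V →ₗ[F] F) : Set {X : Submodule F V // finrank F X = 2} :=
  {X | ∀ x ∈ X.1, ∀ y ∈ X.1, η x y = 0}

/-- The image of the line Hermitian Grassmannian under the Plücker embedding. -/
def hermitianLineVariety (η : V →ₛₗ[σ] V →ₗ[F] F) : Set (ℙ F (⋀[F]^2 V)) :=
  pluecker 2 '' isotropicLines η

end Hermitian

section Codes

variable {F W : Type*} [Field F] [AddCommGroup W] [Module F W] {N : ℕ}

/-- `ω₁, …, ω_N` are vector representatives of the points of `Ω`, each point of `Ω` being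
represented exactly once. -/
structure IsRepresentativeSystem (Ω : Set (ℙ F W)) (ω : Fin N → W) : Prop where
  ne_zero : ∀ i, ω i ≠ 0
  bijOn : Set.BijOn (fun i => Projectivization.mk F (ω i) (ne_zero i)) Set.univ Ω

/-- The projective code with columns `ω₁, …, ω_N`: its words are `(φ(ω₁), …, φ(ω_N))` for `φ` in
the dual space of `W`. In coordinates with respect to a basis of `W`, this is the row space of the
matrix whose columns are `ω₁, …, ω_N`. -/
def projectiveCode (ω : Fin N → W) : Submodule F (Fin N → F) :=
  LinearMap.range (LinearMap.pi fun i => Dual.eval F W (ω i))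

/-- `d` is the minimum Hamming distance between two distinct words of `C`. -/
def IsMinimumDistance [DecidableEq F] (C : Submodule F (Fin N → F)) (d : ℕ) : Prop :=
  IsLeast {n | ∃ x ∈ C, ∃ y ∈ C, x ≠ y ∧ hammingDist x y = n} d

end Codes

end HermitianGrassmann

set_option linter.unusedSectionVars false

/-! A functional `φ` on `⋀²V` is the same as an alternating form `B`, and the weight of its word is
the number of totally isotropic lines on which `B` does not vanish. Each line has `(q^4-1)(q^4-q^2)`
ordered bases, so it suffices to count pairs `(u, v)` that span such a line (`activePairs`). Write
`B u v = η (f u) v` with `f` semilinear, and put `dim V = n + 4`. For fixed isotropic `u`, the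
admissible `v` are the isotropic vectors of `u^⊥` outside `⟨u, f u⟩^⊥`. The number of isotropic
vectors of a subspace depends only on its dimension and that of its radical
(`ncard_isotropicVectors`), and `u ⊥ f u` always. Hence the count for `u` depends only on whether `f
u` is a multiple of `u`, and if not, on whether `f u` is isotropic. With `I`, `E`, `D` the numbers
of isotropic vectors, of isotropic eigenvectors of `f`, and of isotropic vectors with anisotropic
image, the weight times `q^4 - 1` is `q^(2n+1) (I - E) + (-1)^n q^n D` (`weightSum`).

Minimizing the weight thus means maximizing `E`, and also `D` when `n` is odd. Solutions of `f u = c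
u` form a Baer-type set, with at most `q^d` elements inside a `d`-dimensional space
(`ncard_fixed_le`). Together with the evenness of the rank of `B`, this settles rank at least four;
rank two is treated by the dimension of the radical of `(ker B)^⊥`. Dimension five needs more: many
eigenvectors force `f²` to be scalar on `(ker B)^⊥` (`square_of_large_fixed`).

The bounds are attained by a form with `f² = -1` for `n = 0, 2`, by a rank-two form on a totally
isotropic line for other even `n`, and by a rank-two form on a tangent line for odd `n`
(`exists_light_form`). Positivity of the minimum makes `φ ↦` word injective, which gives the
dimension; counting all isotropic pairs gives the length. -/

namespace HermitianGrassmann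

/-! ### Double counting of finite relations. -/

section Counting

theorem ncard_pairs_eq_sum {α β : Type*} [Fintype α] [Finite β] (r : α → β → Prop) :
    {p : α × β | r p.1 p.2}.ncard = ∑ a, {b | r a b}.ncard := by
  classical
  have := Fintype.ofFinite β
  rw [← Nat.card_coe_set_eq]
  simp_rw [← Nat.card_coe_set_eq]
  rw [← Nat.card_sigma]
  exact Nat.card_congr
    { toFun := fun p => ⟨p.1.1, p.1.2, p.2⟩
      invFun := fun p => ⟨(p.1, p.2.1), p.2.2⟩
      left_inv := fun _ => rfl
      right_inv := fun _ => rfl }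

theorem sum_ite_mem_eq_ncard_mul {α : Type*} [Fintype α] (S : Set α) [DecidablePred (· ∈ S)]
    (c : ℤ) : ∑ a, (if a ∈ S then c else 0) = S.ncard * c := by
  rw [Set.ncard_eq_toFinset_card', ← Finset.sum_filter, Finset.sum_const, nsmul_eq_mul,
    Set.filter_mem_univ_eq_toFinset]

theorem ncard_pairs_of_constant {α β : Type*} [Finite α] [Finite β] (r : α → β → Prop)
    (S : Set α) (c : ℕ) (h : ∀ a ∈ S, {b | r a b}.ncard = c)
    (h0 : ∀ a ∉ S, ∀ b, ¬ r a b) :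
    {p : α × β | r p.1 p.2}.ncard = S.ncard * c := by
  classical
  have := Fintype.ofFinite α
  have h1 : ∀ a, ({b | r a b}.ncard : ℤ) = if a ∈ S then (c : ℤ) else 0 := by
    intro a
    split_ifs with ha
    · rw [h a ha]
    · have : {b | r a b} = ∅ := by ext b; simpa using h0 a ha b
      rw [this]; simp
  zify
  rw [ncard_pairs_eq_sum]
  push_cast
  simp_rw [h1]
  exact sum_ite_mem_eq_ncard_mul S c

end Counting

/-! ### Hermitian spaces over a finite field: norms, orthogonal complements, polarization. -/

variable {F V : Type*} [Field F] [AddCommGroup V] [Module F V] {σ : F →+* F}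

/-- The standing data: `F` has `q ^ 2` elements, `σ` is `x ↦ x ^ q` and `η` is a nondegenerate
`σ`-Hermitian form. -/
structure IsHermitianSpace (q : ℕ) (η : V →ₛₗ[σ] V →ₗ[F] F) : Prop where
  card_eq : Nat.card F = q ^ 2
  frob : ∀ x, σ x = x ^ q
  symm : ∀ x y, σ (η x y) = η y x
  nondeg : ∀ x, (∀ y, η x y = 0) → x = 0

/-- The isotropic vectors of a subspace, the zero vector included. -/
def isotropicVectors (η : V →ₛₗ[σ] V →ₗ[F] F) (W : Submodule F V) : Set V :=
  {v | v ∈ W ∧ η v v = 0}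

/-- The orthogonal complement of a subspace. -/
abbrev perp (η : V →ₛₗ[σ] V →ₗ[F] F) (W : Submodule F V) : Submodule F V :=
  W.orthogonalBilin η

namespace IsHermitianSpace

variable {q : ℕ} {η : V →ₛₗ[σ] V →ₗ[F] F} [Finite F]

section Field

theorem two_le (h : IsHermitianSpace q η) : 2 ≤ q := by
  have h1 : 1 < Nat.card F := Finite.one_lt_card
  rw [h.card_eq] at h1
  by_contra hq
  interval_cases q <;> simp at h1

theorem star_star (h : IsHermitianSpace q η) (x : F) : σ (σ x) = x := by
  have := Fintype.ofFinite F
  rw [h.frob, h.frob, ← pow_mul, ← sq, ← h.card_eq, Nat.card_eq_fintype_card, FiniteField.pow_card]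

theorem ncard_norm_fiber_le (h : IsHermitianSpace q η) (t : F) :
    {a : F | σ a * a = t}.ncard ≤ q + 1 := by
  classical
  have h1 : {a : F | σ a * a = t} ⊆ ((Polynomial.nthRoots (q + 1) t).toFinset : Set F) := by
    intro a ha
    simp only [Set.mem_ofPred_eq, h.frob, ← pow_succ] at ha
    simp [Polynomial.mem_nthRoots, ha]
  refine (Set.ncard_le_ncard h1).trans ?_
  rw [Set.ncard_coe_finset]
  exact (Multiset.toFinset_card_le _).trans (Polynomial.card_nthRoots _ _)

theorem ncard_fixed_le (h : IsHermitianSpace q η) : {t : F | σ t = t}.ncard ≤ q := by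
  classical
  have h2 := h.two_le
  have h1 : {t : F | σ t = t} ⊆
      ((insert 0 (Polynomial.nthRoots (q - 1) (1 : F)).toFinset : Finset F) : Set F) := by
    intro a ha
    simp only [Set.mem_ofPred_eq, h.frob] at ha
    by_cases h0 : a = 0
    · simp [h0]
    · have : a ^ (q - 1) = 1 := by
        have h3 : a ^ (q - 1) * a = 1 * a := by
          rw [← pow_succ, Nat.sub_add_cancel (by omega), ha, one_mul]
        exact mul_right_cancel₀ h0 h3
      simp [Polynomial.mem_nthRoots (show 0 < q - 1 by omega), this]
  refine (Set.ncard_le_ncard h1).trans ?_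
  rw [Set.ncard_coe_finset]
  refine (Finset.card_insert_le _ _).trans ?_
  have := (Multiset.toFinset_card_le _).trans (Polynomial.card_nthRoots (q - 1) (1 : F))
  omega

theorem exists_not_fixed (h : IsHermitianSpace q η) : ∃ a : F, σ a ≠ a := by
  by_contra! hc
  have h1 := h.ncard_fixed_le
  have h2 : {t : F | σ t = t} = Set.univ := by ext; simp [hc]
  rw [h2, Set.ncard_univ, h.card_eq] at h1
  have := h.two_le
  nlinarith

/-- Pigeonhole: the `q^2 - 1` nonzero scalars have norms among at most `q - 1` nonzero fixed
elements, and each fibre has at most `q + 1` points, so every fibre is full. -/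
theorem ncard_norm_fiber (h : IsHermitianSpace q η) {t : F} (ht : t ≠ 0) (hs : σ t = t) :
    {a : F | σ a * a = t}.ncard = q + 1 := by
  classical
  have := Fintype.ofFinite F
  refine le_antisymm (h.ncard_norm_fiber_le t) ?_
  by_contra! hlt
  let T : Finset F := Finset.univ.filter fun t => t ≠ 0 ∧ σ t = t
  have hT : T.card ≤ q - 1 := by
    have h1 : (insert 0 T).card ≤ q := by
      refine le_trans (le_of_eq ?_) h.ncard_fixed_le
      rw [← Set.ncard_coe_finset]
      congr 1
      ext x
      by_cases hx : x = 0 <;> simp [T, hx]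
    rw [Finset.card_insert_of_notMem (by simp [T])] at h1
    omega
  have hmem : t ∈ T := by simp [T, ht, hs]
  have hc : (Finset.univ.erase (0 : F)).card =
      ∑ b ∈ T, ((Finset.univ.erase (0 : F)).filter fun a => σ a * a = b).card := by
    refine Finset.card_eq_sum_card_fiberwise fun a ha => ?_
    simp only [Finset.coe_erase, Finset.coe_univ, Set.mem_sdiff, Set.mem_univ,
      Set.mem_singleton_iff, true_and] at ha
    simp [T, ha, h.star_star, mul_comm]
  have hfib : ∀ b, ((Finset.univ.erase (0 : F)).filter fun a => σ a * a = b).card ≤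
      {a : F | σ a * a = b}.ncard := by
    intro b
    rw [← Set.ncard_coe_finset]
    refine Set.ncard_le_ncard fun a ha => ?_
    simp only [Finset.coe_filter, Set.mem_ofPred_eq] at ha
    exact ha.2
  have h3 : ∑ b ∈ T, ((Finset.univ.erase (0 : F)).filter fun a => σ a * a = b).card
      < ∑ b ∈ T, (q + 1) :=
    Finset.sum_lt_sum (fun b _ => (hfib b).trans (h.ncard_norm_fiber_le b))
      ⟨t, hmem, (hfib t).trans_lt hlt⟩
  rw [← hc, Finset.sum_const, smul_eq_mul, Finset.card_erase_of_mem (Finset.mem_univ _),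
    Finset.card_univ, ← Nat.card_eq_fintype_card, h.card_eq] at h3
  have h4 : T.card * (q + 1) ≤ (q - 1) * (q + 1) := Nat.mul_le_mul_right _ hT
  obtain ⟨k, rfl⟩ : ∃ k, q = k + 2 := ⟨q - 2, by have := h.two_le; omega⟩
  have h5 : (k + 2) ^ 2 - 1 = (k + 2 - 1) * (k + 2 + 1) := by
    rw [show k + 2 - 1 = k + 1 by omega]
    exact Nat.sub_eq_of_eq_add (by ring)
  omega

end Field

theorem isRefl (h : IsHermitianSpace q η) {x y : V} (hxy : η x y = 0) : η y x = 0 := by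
  rw [← h.symm, hxy, map_zero]

theorem star_self (h : IsHermitianSpace q η) (x : V) : σ (η x x) = η x x := h.symm x x

variable [Finite V]

theorem natCard_submodule (h : IsHermitianSpace q η) (W : Submodule F V) :
    Nat.card W = q ^ (2 * finrank F W) := by
  rw [Module.natCard_eq_pow_finrank (K := F), h.card_eq, pow_mul]

theorem ncard_submodule (h : IsHermitianSpace q η) (W : Submodule F V) :
    (W : Set V).ncard = q ^ (2 * finrank F W) := by
  rw [← h.natCard_submodule W]; rfl

theorem natCard_space (h : IsHermitianSpace q η) : Nat.card V = q ^ (2 * finrank F V) := by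
  rw [Module.natCard_eq_pow_finrank (K := F), h.card_eq, pow_mul]

theorem pow_two_mul_inj (h : IsHermitianSpace q η) {a b : ℕ} (hab : q ^ (2 * a) = q ^ (2 * b)) :
    a = b := by
  have := Nat.pow_right_injective h.two_le hab
  omega

/-- Nondegeneracy makes `x ↦ η x` injective, and `V` and its dual have equally many elements. -/
theorem surjective_toDual (h : IsHermitianSpace q η) (α : Dual F V) : ∃ x, ∀ y, η x y = α y := by
  have : Finite (Dual F V) := Module.finite_of_finite F
  have hinj : Function.Injective (fun x => η x) := by
    intro x y hxy
    rw [← sub_eq_zero]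
    refine h.nondeg _ fun z => ?_
    rw [map_sub, LinearMap.sub_apply]
    simp only at hxy
    rw [hxy, sub_self]
  have hb := hinj.bijective_of_nat_card_le (by
    rw [Module.natCard_eq_pow_finrank (K := F) (V := Dual F V), Subspace.dual_finrank_eq,
      ← Module.natCard_eq_pow_finrank])
  obtain ⟨x, hx⟩ := hb.2 α
  exact ⟨x, fun y => by rw [← hx]⟩

/-- The map `y ↦ η y` restricted to `W` is additive and onto the dual of `W`, with kernel `W^⊥`. As
it is only semilinear, Lagrange's theorem on cardinalities takes the place of rank-nullity. -/
theorem finrank_perp (h : IsHermitianSpace q η) (W : Submodule F V) :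
    finrank F W + finrank F (perp η W) = finrank F V := by
  have : Finite (Dual F W) := Module.finite_of_finite F
  let g : V →+ Dual F W :=
    { toFun := fun y => (η y).domRestrict W
      map_zero' := by ext; simp
      map_add' := fun x y => by ext; simp }
  have hg : Function.Surjective g := by
    intro α
    obtain ⟨β, hβ⟩ := LinearMap.exists_extend α
    obtain ⟨x, hx⟩ := h.surjective_toDual β
    refine ⟨x, ?_⟩
    ext w
    rw [← hβ]
    exact hx w
  have h1 := AddSubgroup.card_eq_card_quotient_mul_card_addSubgroup g.ker
  rw [Nat.card_congr (QuotientAddGroup.quotientKerEquivOfSurjective g hg).toEquiv] at h1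
  have h2 : Nat.card g.ker = Nat.card (perp η W) := by
    refine Nat.card_congr (Equiv.subtypeEquivRight fun y => ?_)
    simp only [AddMonoidHom.mem_ker, Submodule.mem_orthogonalBilin_iff]
    constructor
    · intro hy n hn
      exact h.isRefl (LinearMap.congr_fun hy ⟨n, hn⟩)
    · intro hy
      ext n
      exact h.isRefl (hy n n.2)
  rw [h2, h.natCard_submodule, h.natCard_space, Module.natCard_eq_pow_finrank (K := F),
    Subspace.dual_finrank_eq, h.card_eq, ← pow_mul, ← pow_add, ← mul_add] at h1
  exact (h.pow_two_mul_inj h1).symm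

theorem perp_perp (h : IsHermitianSpace q η) (W : Submodule F V) : perp η (perp η W) = W := by
  have h1 := h.finrank_perp W
  have h2 := h.finrank_perp (perp η W)
  have h3 : W ≤ perp η (perp η W) := fun x hx y hy => h.isRefl (hy x hx)
  exact (Submodule.eq_of_le_of_finrank_eq h3 (by omega)).symm

theorem mem_perp_span {s : Set V} {v : V} :
    v ∈ perp η (Submodule.span F s) ↔ ∀ x ∈ s, η x v = 0 := by
  constructor
  · intro hv x hx
    exact hv x (Submodule.subset_span hx)
  · intro hv x hx
    induction hx using Submodule.span_induction with
    | mem x hx => exact hv x hx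
    | zero => simp
    | add x y _ _ h1 h2 => rw [map_add, LinearMap.add_apply, h1, h2, add_zero]
    | smul a x _ h1 => rw [map_smulₛₗ, LinearMap.smul_apply, h1, smul_zero]

/-- Polarization: a Hermitian form vanishing on the diagonal of a subspace vanishes on it. -/
theorem eq_zero_of_isotropic (h : IsHermitianSpace q η) {W : Submodule F V}
    (hW : ∀ w ∈ W, η w w = 0) {x y : V} (hx : x ∈ W) (hy : y ∈ W) : η x y = 0 := by
  obtain ⟨a, ha⟩ := h.exists_not_fixed
  have key : ∀ b : F, b * η x y + σ b * η y x = 0 := by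
    intro b
    have h1 := hW (x + b • y) (W.add_mem hx (W.smul_mem b hy))
    simp only [map_add, map_smulₛₗ, LinearMap.add_apply, LinearMap.smul_apply, smul_eq_mul,
      hW x hx, hW y hy, mul_zero, zero_add, add_zero] at h1
    linear_combination h1
  -- Two choices of `b`, namely `1` and an element moved by `σ`, eliminate `η y x`; this works in
  -- every characteristic.
  have h1 := key 1
  have h2 := key a
  rw [map_one] at h1
  have h3 : (a - σ a) * η x y = 0 := by linear_combination h2 - σ a * h1
  exact (mul_eq_zero.1 h3).resolve_left (sub_ne_zero.2 (Ne.symm ha))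

end IsHermitianSpace

/-! ### The number of isotropic vectors of a subspace. -/

namespace IsHermitianSpace

variable {q : ℕ} {η : V →ₛₗ[σ] V →ₗ[F] F} [Finite F] [Finite V]

theorem self_smul_add (η : V →ₛₗ[σ] V →ₗ[F] F) {w x : V} (hwx : η w x = 0) (hxw : η x w = 0)
    (a : F) : η (a • w + x) (a • w + x) = σ a * a * η w w + η x x := by
  simp only [map_add, map_smulₛₗ, LinearMap.add_apply, LinearMap.smul_apply, smul_eq_mul,
    hwx, hxw, RingHom.id_apply]
  ring

/-- The orthogonal decomposition `W = F w ⊕ (W ∩ w^⊥)` for anisotropic `w`. The predicate `P` lets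
it serve both for counting all vectors and for counting isotropic ones. -/
theorem bijOn_split {W : Submodule F V} {w : V} (hw : w ∈ W)
    (hww : η w w ≠ 0) (P : V → Prop) :
    Set.BijOn (fun p : F × V => p.1 • w + p.2)
      {p | p.2 ∈ W ⊓ perp η (F ∙ w) ∧ P (p.1 • w + p.2)} {v | v ∈ W ∧ P v} := by
  refine ⟨?_, ?_, ?_⟩
  · rintro ⟨a, x⟩ ⟨hx, hP⟩
    exact ⟨W.add_mem (W.smul_mem a hw) hx.1, hP⟩
  · rintro ⟨a, x⟩ ⟨hx, -⟩ ⟨b, y⟩ ⟨hy, -⟩ hxy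
    have hx' : η w x = 0 := hx.2 w (Submodule.mem_span_singleton_self w)
    have hy' : η w y = 0 := hy.2 w (Submodule.mem_span_singleton_self w)
    simp only at hxy
    have h1 := congrArg (η w) hxy
    simp only [map_add, map_smul, hx', hy', add_zero, smul_eq_mul] at h1
    have hab : a = b := mul_right_cancel₀ hww h1
    subst hab
    simpa using hxy
  · rintro v ⟨hv, hP⟩
    have h1 : v = (η w v / η w w) • w + (v - (η w v / η w w) • w) := by abel
    refine ⟨(η w v / η w w, v - (η w v / η w w) • w), ⟨⟨W.sub_mem hv (W.smul_mem _ hw), ?_⟩, ?_⟩,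
      h1.symm⟩
    · refine mem_perp_span.2 ?_
      rintro x rfl
      rw [map_sub, map_smul, smul_eq_mul, div_mul_cancel₀ _ hww, sub_self]
    · simpa using hP

theorem finrank_inf_perp_singleton (h : IsHermitianSpace q η) {W : Submodule F V} {w : V}
    (hw : w ∈ W) (hww : η w w ≠ 0) :
    finrank F W = finrank F (W ⊓ perp η (F ∙ w) : Submodule F V) + 1 := by
  have h1 := (bijOn_split hw hww fun _ => True).ncard_eq
  have h2 := ncard_pairs_of_constant (fun (x : F) (y : V) => y ∈ W ⊓ perp η (F ∙ w)) Set.univ _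
    (fun a _ => h.ncard_submodule (W ⊓ perp η (F ∙ w))) (by simp)
  simp only [and_true] at h1
  rw [h2, Set.ncard_univ, h.card_eq, ← pow_add] at h1
  have h3 : {v | v ∈ W}.ncard = q ^ (2 * finrank F W) := h.ncard_submodule W
  rw [h3] at h1
  have := Nat.pow_right_injective h.two_le h1
  omega

theorem rad_inf_perp_singleton {W : Submodule F V} {w : V}
    (hw : w ∈ W) (hww : η w w ≠ 0) :
    (W ⊓ perp η (F ∙ w)) ⊓ perp η (W ⊓ perp η (F ∙ w)) = W ⊓ perp η W := by
  ext v
  constructor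
  · rintro ⟨⟨h1, h2⟩, h3⟩
    refine ⟨h1, fun x hx => ?_⟩
    obtain ⟨⟨a, y⟩, ⟨hy, -⟩, rfl⟩ := (bijOn_split hw hww fun _ => True).surjOn ⟨hx, trivial⟩
    rw [map_add, LinearMap.add_apply, h3 y hy, map_smulₛₗ, LinearMap.smul_apply,
      h2 w (Submodule.mem_span_singleton_self w), smul_zero, zero_add]
  · rintro ⟨h1, h2⟩
    refine ⟨⟨h1, ?_⟩, fun x hx => h2 x hx.1⟩
    refine mem_perp_span.2 ?_
    rintro x rfl
    exact h2 x hw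

/-- The vector `a w + x` is isotropic iff the norm of `a` is `-η x x / η w w`. Only `a = 0`
qualifies when `x` is isotropic, and `q + 1` scalars do otherwise. -/
theorem ncard_isotropic_split (h : IsHermitianSpace q η) {W : Submodule F V} {w : V}
    (hw : w ∈ W) (hww : η w w ≠ 0) :
    ((isotropicVectors η W).ncard : ℤ) + q * (isotropicVectors η (W ⊓ perp η (F ∙ w))).ncard =
      (q + 1) * q ^ (2 * finrank F (W ⊓ perp η (F ∙ w) : Submodule F V)) := by
  set W' := W ⊓ perp η (F ∙ w) with hW'
  have hperp : ∀ x ∈ W', η w x = 0 := fun x hx => hx.2 w (Submodule.mem_span_singleton_self w)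
  have h1 := (bijOn_split hw hww fun v => η v v = 0).ncard_eq
  have h2 : {p : F × V | p.2 ∈ W' ∧ η (p.1 • w + p.2) (p.1 • w + p.2) = 0}.ncard =
      {p : V × F | p.1 ∈ W' ∧ σ p.2 * p.2 * η w w + η p.1 p.1 = 0}.ncard := by
    rw [← Set.ncard_image_of_injective _ Prod.swap_injective]
    congr 1
    ext ⟨x, a⟩
    constructor
    · rintro ⟨⟨b, y⟩, ⟨hy, hy'⟩, hyx⟩
      cases hyx
      exact ⟨hy, by rw [← self_smul_add η (hperp _ hy) (h.isRefl (hperp _ hy))]; exact hy'⟩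
    · rintro ⟨hx, hx'⟩
      rw [← self_smul_add η (hperp _ hx) (h.isRefl (hperp _ hx))] at hx'
      exact ⟨(a, x), ⟨hx, hx'⟩, rfl⟩
  rw [h1] at h2
  have hsplit : {p : V × F | p.1 ∈ W' ∧ σ p.2 * p.2 * η w w + η p.1 p.1 = 0} =
      {p : V × F | p.1 ∈ isotropicVectors η W' ∧ p.2 = 0} ∪
      {p : V × F | p.1 ∈ (W' : Set V) \ isotropicVectors η W' ∧
        σ p.2 * p.2 = - η p.1 p.1 / η w w} := by
    ext ⟨x, a⟩
    simp only [isotropicVectors, Set.mem_ofPred_eq, Set.mem_union, Set.mem_sdiff, SetLike.mem_coe,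
      eq_div_iff hww, eq_neg_iff_add_eq_zero]
    by_cases hx : x ∈ W'
    · by_cases hxx : η x x = 0
      · simp [hx, hxx, hww]
      · simp [hx, hxx]
    · simp [hx]
  have hdisj : Disjoint {p : V × F | p.1 ∈ isotropicVectors η W' ∧ p.2 = 0}
      {p : V × F | p.1 ∈ (W' : Set V) \ isotropicVectors η W' ∧
        σ p.2 * p.2 = - η p.1 p.1 / η w w} := by
    rw [Set.disjoint_left]
    rintro ⟨x, a⟩ h1 h2
    exact h2.1.2 h1.1
  have c1 := ncard_pairs_of_constant (fun (x : V) (a : F) => x ∈ isotropicVectors η W' ∧ a = 0)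
    (isotropicVectors η W') 1 (fun x hx => by simp [hx]) (fun x hx b hb => hx hb.1)
  have c2 := ncard_pairs_of_constant
    (fun (x : V) (a : F) => x ∈ (W' : Set V) \ isotropicVectors η W' ∧
        σ a * a = - η x x / η w w) ((W' : Set V) \ isotropicVectors η W') (q + 1)
    (fun x hx => by
      simp only [hx, true_and]
      refine h.ncard_norm_fiber ?_ ?_
      · exact div_ne_zero (neg_ne_zero.2 fun h0 => hx.2 ⟨hx.1, h0⟩) hww
      · rw [map_div₀, map_neg, h.star_self, h.star_self])
    (fun x hx b hb => hx hb.1)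
  rw [hsplit, Set.ncard_union_eq hdisj, c1, c2] at h2
  have hsub : isotropicVectors η W' ⊆ (W' : Set V) := fun x hx => hx.1
  have h4 := Set.ncard_sdiff_add_ncard_of_subset hsub
  rw [h.ncard_submodule] at h4
  have h5 : (isotropicVectors η W).ncard = (isotropicVectors η W').ncard * 1 +
    ((W' : Set V) \ isotropicVectors η W').ncard * (q + 1) := h2
  zify at h4 h5
  rw [h5]
  linear_combination (q + 1 : ℤ) * h4

/-- The number of isotropic vectors of a subspace of dimension `n` whose radical has
dimension `ρ`. -/
theorem ncard_isotropicVectors (h : IsHermitianSpace q η) (W : Submodule F V) :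
    (q : ℤ) * (isotropicVectors η W).ncard = q ^ (2 * finrank F W) +
      (-1) ^ (finrank F W + finrank F (W ⊓ perp η W : Submodule F V)) * (q - 1) *
        q ^ (finrank F W + finrank F (W ⊓ perp η W : Submodule F V)) := by
  -- The factor `q` on the left avoids the exponent `n + ρ - 1`, which is negative for the zero
  -- space.
  induction hn : finrank F W generalizing W with
  | zero =>
    have hW : W = ⊥ := Submodule.finrank_eq_zero.1 hn
    subst hW
    have : isotropicVectors η (⊥ : Submodule F V) = {0} := by
      ext x; simp +contextual [isotropicVectors]
    rw [bot_inf_eq, this]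
    simp
  | succ n ih =>
    by_cases hiso : ∀ w ∈ W, η w w = 0
    · have h1 : W ⊓ perp η W = W :=
        inf_eq_left.2 fun x hx y hy => h.eq_zero_of_isotropic hiso hy hx
      have h2 : isotropicVectors η W = (W : Set V) := by
        ext x
        exact ⟨fun hx => hx.1, fun hx => ⟨hx, hiso x hx⟩⟩
      rw [h1, h2, h.ncard_submodule, hn, ← two_mul, Even.neg_one_pow (even_two_mul _)]
      push_cast
      ring
    -- Splitting off an anisotropic vector lowers the dimension by one and keeps the radical, which
    -- is where the sign alternates.
    · push Not at hiso
      obtain ⟨w, hw, hww⟩ := hiso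
      have h1 := h.finrank_inf_perp_singleton hw hww
      have h2 := h.ncard_isotropic_split hw hww
      have h3 := ih (W ⊓ perp η (F ∙ w)) (by omega)
      rw [rad_inf_perp_singleton hw hww] at h3
      have h4 : finrank F (W ⊓ perp η (F ∙ w) : Submodule F V) = n := by omega
      rw [h4] at h2
      set ρ := finrank F (W ⊓ perp η W : Submodule F V)
      rw [show n + 1 + ρ = (n + ρ) + 1 by ring, show 2 * (n + 1) = 2 * n + 1 + 1 by ring]
      simp only [pow_succ]
      linear_combination (q : ℤ) * h2 - q * h3

end IsHermitianSpace

/-! ### Alternating forms have even rank. -/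

section EvenRank

variable [FiniteDimensional F V] (B : V →ₗ[F] V →ₗ[F] F)

/-- If `B a b ≠ 0` in `W`, the plane `⟨a, b⟩` splits off orthogonally: the complement in `W` has the
same radical and dimension smaller by two. -/
theorem even_finrank_add_finrank_rad (hB : ∀ x, B x x = 0) (W : Submodule F V) :
    Even (finrank F W + finrank F (W ⊓ W.orthogonalBilin B : Submodule F V)) := by
  have hneg : ∀ x y, B x y = - B y x := by
    intro x y
    have h1 := hB (x + y)
    simp only [map_add, LinearMap.add_apply, hB, zero_add, add_zero] at h1
    linear_combination h1
  induction hn : finrank F W using Nat.strong_induction_on generalizing W with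
  | _ n ih =>
    by_cases h0 : ∀ x ∈ W, ∀ y ∈ W, B x y = 0
    · have h1 : W ⊓ W.orthogonalBilin B = W := inf_eq_left.2 fun x hx y hy => h0 y hy x hx
      rw [h1, hn]
      exact ⟨n, rfl⟩
    · push Not at h0
      obtain ⟨a, ha, b, hb, hab⟩ := h0
      set S := Submodule.span F ({a, b} : Set V) with hS
      have hba : B b a = - B a b := hneg b a
      have hSW : S ≤ W := by
        rw [hS, Submodule.span_le]
        rintro x (rfl | rfl) <;> assumption
      set W' := W ⊓ LinearMap.ker (B a) ⊓ LinearMap.ker (B b) with hW'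
      have hli : LinearIndependent F ![a, b] := by
        rw [LinearIndependent.pair_iff]
        intro s t hst
        have h1 := congrArg (B a) hst
        have h2 := congrArg (B b) hst
        simp only [map_add, map_smul, hB, smul_eq_mul, mul_zero, zero_add, add_zero, map_zero,
          mul_eq_zero, hba, neg_eq_zero, hab, or_false] at h1 h2
        exact ⟨h2, h1⟩
      have hSdim : finrank F S = 2 := by
        have := finrank_span_eq_card hli
        rwa [Matrix.range_cons_cons_empty, Fintype.card_fin] at this
      have hdec : ∀ x ∈ W, ∃ s ∈ S, ∃ y ∈ W', s + y = x := by
        intro x hx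
        refine ⟨(- B b x / B a b) • a + (B a x / B a b) • b, ?_,
          x - ((- B b x / B a b) • a + (B a x / B a b) • b), ⟨⟨?_, ?_⟩, ?_⟩, by abel⟩
        · exact S.add_mem (S.smul_mem _ (Submodule.subset_span (by simp)))
            (S.smul_mem _ (Submodule.subset_span (by simp)))
        · exact W.sub_mem hx (W.add_mem (W.smul_mem _ ha) (W.smul_mem _ hb))
        · simp only [SetLike.mem_coe, LinearMap.mem_ker, map_sub, map_add, map_smul, hB,
            smul_eq_mul, mul_zero, zero_add, div_mul_cancel₀ _ hab, sub_self]
        · simp only [SetLike.mem_coe, LinearMap.mem_ker, map_sub, map_add, map_smul, hB,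
            smul_eq_mul, mul_zero, add_zero, hba, mul_neg, div_mul_cancel₀ _ hab, neg_neg,
            sub_self]
      have hsup : S ⊔ W' = W := by
        refine le_antisymm (sup_le hSW fun x hx => hx.1.1) fun x hx => ?_
        obtain ⟨s, hs, y, hy, rfl⟩ := hdec x hx
        exact Submodule.add_mem_sup hs hy
      have hinf : S ⊓ W' = ⊥ := by
        rw [Submodule.eq_bot_iff]
        rintro x ⟨hxS, ⟨-, h1⟩, h2⟩
        obtain ⟨s, t, rfl⟩ := Submodule.mem_span_pair.1 hxS
        simp only [SetLike.mem_coe, LinearMap.mem_ker, map_add, map_smul, hB, smul_eq_mul,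
          mul_zero, zero_add, add_zero, mul_eq_zero, hba, neg_eq_zero, hab, or_false] at h1 h2
        simp [h1, h2]
      have hdim := Submodule.finrank_sup_add_finrank_inf_eq S W'
      rw [hsup, hinf, finrank_bot, hSdim] at hdim
      have hrad : W' ⊓ W'.orthogonalBilin B = W ⊓ W.orthogonalBilin B := by
        ext v
        constructor
        · rintro ⟨⟨⟨h1, h2⟩, h3⟩, h4⟩
          refine ⟨h1, fun x hx => ?_⟩
          obtain ⟨s, hs, y, hy, rfl⟩ := hdec x hx
          obtain ⟨c, d, rfl⟩ := Submodule.mem_span_pair.1 hs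
          rw [SetLike.mem_coe, LinearMap.mem_ker] at h2 h3
          simp [h4 y hy, h2, h3]
        · rintro ⟨h1, h2⟩
          exact ⟨⟨⟨h1, h2 a ha⟩, h2 b hb⟩, fun x hx => h2 x hx.1.1⟩
      have := ih _ (by omega) W' rfl
      rw [hrad] at this
      rw [show n = finrank F W' + 2 by omega]
      rw [Nat.even_iff] at this ⊢
      omega

theorem even_finrank_add_finrank_ker (hB : ∀ x, B x x = 0) :
    Even (finrank F V + finrank F (LinearMap.ker B)) := by
  have h1 := even_finrank_add_finrank_rad B hB ⊤
  have h2 : (⊤ : Submodule F V) ⊓ (⊤ : Submodule F V).orthogonalBilin B = LinearMap.ker B := by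
    ext x
    simp only [Submodule.mem_inf, Submodule.mem_top, true_and, Submodule.mem_orthogonalBilin_iff,
      true_imp_iff, LinearMap.mem_ker]
    have hneg : ∀ x y, B x y = - B y x := by
      intro x y
      have h1 := hB (x + y)
      simp only [map_add, LinearMap.add_apply, hB, zero_add, add_zero] at h1
      linear_combination h1
    constructor
    · intro h
      ext y
      rw [hneg, h y, neg_zero, LinearMap.zero_apply]
    · intro h y
      rw [hneg, h, LinearMap.zero_apply, neg_zero]
  rwa [h2, finrank_top] at h1

end EvenRank

theorem finrank_span_pair {a b : V} (hab : LinearIndependent F ![a, b]) :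
    finrank F (Submodule.span F ({a, b} : Set V)) = 2 := by
  have := finrank_span_eq_card hab
  rwa [Matrix.range_cons_cons_empty, Fintype.card_fin] at this

theorem linearIndependent_pair_of_not_smul {a b : V} (ha : a ≠ 0) (hb : ∀ c : F, b ≠ c • a) :
    LinearIndependent F ![a, b] := by
  rw [LinearIndependent.pair_iff' ha]
  exact fun c hc => hb c hc.symm

/-! ### Isotropic vectors in the complement of a point or a line. -/

namespace IsHermitianSpace

variable {q : ℕ} {η : V →ₛₗ[σ] V →ₗ[F] F} [Finite F] [Finite V]

theorem rad_perp (h : IsHermitianSpace q η) (S : Submodule F V) :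
    perp η S ⊓ perp η (perp η S) = S ⊓ perp η S := by
  rw [h.perp_perp, inf_comm]

theorem ncard_isotropicVectors_top (h : IsHermitianSpace q η) :
    (q : ℤ) * (isotropicVectors η ⊤).ncard = q ^ (2 * finrank F V) +
      (-1) ^ finrank F V * (q - 1) * q ^ finrank F V := by
  have h1 := h.ncard_isotropicVectors ⊤
  have h2 : finrank F ((⊤ : Submodule F V) ⊓ perp η ⊤ : Submodule F V) = 0 := by
    rw [top_inf_eq]
    have := h.finrank_perp ⊤
    rw [finrank_top] at this
    omega
  rwa [h2, finrank_top, add_zero] at h1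

theorem finrank_rad_singleton {u : V} (hu : u ≠ 0)
    (huu : η u u = 0) : finrank F ((F ∙ u) ⊓ perp η (F ∙ u) : Submodule F V) = 1 := by
  rw [inf_eq_left.2, finrank_span_singleton hu]
  rw [Submodule.span_singleton_le_iff_mem, mem_perp_span]
  rintro x rfl
  exact huu

theorem ncard_isotropicVectors_perp_singleton (h : IsHermitianSpace q η) {n : ℕ}
    (hV : finrank F V = n + 4) {u : V} (hu : u ≠ 0) (huu : η u u = 0) :
    (q : ℤ) * (isotropicVectors η (perp η (F ∙ u))).ncard = q ^ (2 * n + 6) +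
      (-1) ^ n * (q - 1) * q ^ (n + 4) := by
  have h1 := h.ncard_isotropicVectors (perp η (F ∙ u))
  have h2 := h.finrank_perp (F ∙ u)
  rw [finrank_span_singleton hu] at h2
  rw [h.rad_perp, finrank_rad_singleton hu huu,
    show finrank F (perp η (F ∙ u)) = n + 3 by omega] at h1
  rw [h1]
  ring

theorem finrank_rad_pair_isotropic (h : IsHermitianSpace q η) {u w : V}
    (huw : LinearIndependent F ![u, w]) (huu : η u u = 0) (huw0 : η u w = 0) (hww : η w w = 0) :
    finrank F (Submodule.span F {u, w} ⊓ perp η (Submodule.span F {u, w}) : Submodule F V) = 2 := by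
  rw [inf_eq_left.2, finrank_span_pair huw]
  rw [Submodule.span_le]
  rintro x (rfl | rfl) <;> refine mem_perp_span.2 ?_
  · rintro x (rfl | rfl)
    · exact huu
    · exact h.isRefl huw0
  · rintro y (rfl | rfl)
    · exact huw0
    · exact hww

theorem rad_pair_anisotropic (h : IsHermitianSpace q η) {u w : V}
    (huu : η u u = 0) (huw0 : η u w = 0) (hww : η w w ≠ 0) :
    (Submodule.span F {u, w} ⊓ perp η (Submodule.span F {u, w}) : Submodule F V) = F ∙ u := by
  refine le_antisymm ?_ ?_
  · rintro x ⟨hx1, hx2⟩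
    obtain ⟨a, b, rfl⟩ := Submodule.mem_span_pair.1 hx1
    have h1 := hx2 w (Submodule.subset_span (by simp))
    simp only [map_add, map_smul, h.isRefl huw0, smul_eq_mul, mul_zero, zero_add, mul_eq_zero,
      hww, or_false] at h1
    rw [h1, zero_smul, add_zero]
    exact Submodule.smul_mem _ _ (Submodule.mem_span_singleton_self u)
  · rw [Submodule.span_singleton_le_iff_mem]
    refine ⟨Submodule.subset_span (by simp), mem_perp_span.2 ?_⟩
    rintro y (rfl | rfl)
    · exact huu
    · exact h.isRefl huw0

/-- By `rad_perp`, `S^⊥` has the same radical as `S`, so `ρ` alone distinguishes the types of lines: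
`0` nondegenerate, `1` tangent, `2` totally isotropic. -/
theorem ncard_isotropicVectors_perp_of_finrank_two (h : IsHermitianSpace q η) {n ρ : ℕ}
    (hV : finrank F V = n + 4) {S : Submodule F V} (hS : finrank F S = 2)
    (hρ : finrank F (S ⊓ perp η S : Submodule F V) = ρ) :
    (q : ℤ) * (isotropicVectors η (perp η S)).ncard = q ^ (2 * n + 4) +
      (-1) ^ (n + ρ) * (q - 1) * q ^ (n + 2 + ρ) := by
  have h1 := h.ncard_isotropicVectors (perp η S)
  have h2 := h.finrank_perp S
  rw [h.rad_perp, hρ, show finrank F (perp η S) = n + 2 by omega] at h1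
  rw [h1]
  ring

end IsHermitianSpace

/-- `B` is an alternating form on a Hermitian space and `f` is the semilinear map that
represents it with respect to the Hermitian form. -/
structure Represents (q : ℕ) (η : V →ₛₗ[σ] V →ₗ[F] F) (B : V →ₗ[F] V →ₗ[F] F) (f : V → V) : Prop
    extends IsHermitianSpace q η where
  alt : ∀ x, B x x = 0
  adj : ∀ u v, η (f u) v = B u v

theorem IsHermitianSpace.exists_represents [Finite F] [Finite V] {q : ℕ} {η : V →ₛₗ[σ] V →ₗ[F] F}
    (h : IsHermitianSpace q η) {B : V →ₗ[F] V →ₗ[F] F} (hB : ∀ x, B x x = 0) :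
    ∃ f, Represents q η B f := by
  choose f hf using fun u => h.surjective_toDual (B u)
  exact ⟨f, h, hB, hf⟩

/-- The isotropic vectors `u` with `f u` a multiple of `u`. -/
def eigenVectors (η : V →ₛₗ[σ] V →ₗ[F] F) (f : V → V) : Set V :=
  {u | η u u = 0 ∧ ∃ c : F, f u = c • u}

/-- The isotropic vectors with anisotropic image under `f`. -/
def escapingVectors (η : V →ₛₗ[σ] V →ₗ[F] F) (f : V → V) : Set V :=
  {u | η u u = 0 ∧ η (f u) (f u) ≠ 0}

/-- The pairs of vectors that span a totally isotropic line on which `B` does not vanish. -/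
def activePairs (η : V →ₛₗ[σ] V →ₗ[F] F) (B : V →ₗ[F] V →ₗ[F] F) : Set (V × V) :=
  {p | η p.1 p.1 = 0 ∧ η p.2 p.2 = 0 ∧ η p.1 p.2 = 0 ∧ B p.1 p.2 ≠ 0}

/-! ### The semilinear map of an alternating form and the count of active pairs. -/

namespace Represents

variable {q : ℕ} {η : V →ₛₗ[σ] V →ₗ[F] F} {B : V →ₗ[F] V →ₗ[F] F} {f : V → V}
variable [Finite F] [Finite V]

theorem eq_of_forall (h : IsHermitianSpace q η) {x y : V} (hxy : ∀ v, η x v = η y v) : x = y := by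
  rw [← sub_eq_zero]
  refine h.nondeg _ fun v => ?_
  rw [map_sub, LinearMap.sub_apply, hxy, sub_self]

theorem map_add (h : Represents q η B f) (u v : V) : f (u + v) = f u + f v :=
  eq_of_forall h.toIsHermitianSpace fun x => by simp [h.adj]

theorem map_smul (h : Represents q η B f) (a : F) (u : V) : f (a • u) = σ a • f u :=
  eq_of_forall h.toIsHermitianSpace fun x => by simp [h.adj, h.star_star]

theorem map_zero (h : Represents q η B f) : f 0 = 0 := by
  simpa using h.map_smul 0 0

theorem neg_flip (h : Represents q η B f) (x y : V) : B x y = - B y x := by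
  have h1 := h.alt (x + y)
  simp only [_root_.map_add, LinearMap.add_apply, h.alt, zero_add, add_zero] at h1
  linear_combination h1

theorem map_self (h : Represents q η B f) (u : V) : η (f u) u = 0 := by rw [h.adj, h.alt]

theorem self_map (h : Represents q η B f) (u : V) : η u (f u) = 0 := h.isRefl (h.map_self u)

/-- Where `f²` acts as a scalar, this shows that `f` sends isotropic vectors to isotropic vectors.
-/
theorem form_map_map (h : Represents q η B f) (u v : V) : η (f u) (f v) = - η (f (f v)) u := by
  rw [h.adj, h.neg_flip, h.adj]

theorem map_eq_zero_iff (h : Represents q η B f) {u : V} : f u = 0 ↔ u ∈ LinearMap.ker B := by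
  rw [LinearMap.mem_ker]
  constructor
  · intro hu
    ext v
    rw [← h.adj, hu]
    simp
  · intro hu
    refine eq_of_forall h.toIsHermitianSpace fun v => ?_
    rw [h.adj, hu]
    simp

/-- Since `(ker B)^⊥` has dimension the rank of `B` and contains the image of `f`, it is used
throughout as the support of `B`. -/
theorem map_mem_perp_ker (h : Represents q η B f) (u : V) : f u ∈ perp η (LinearMap.ker B) := by
  intro r hr
  refine h.isRefl ?_
  rw [h.adj, h.neg_flip, LinearMap.mem_ker.1 hr]
  simp

theorem zero_mem_eigenVectors (h : Represents q η B f) : (0 : V) ∈ eigenVectors η f :=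
  ⟨by simp, 0, by rw [h.map_zero, smul_zero]⟩

theorem disjoint_escaping_eigen : Disjoint (escapingVectors η f) (eigenVectors η f) := by
  rw [Set.disjoint_left]
  rintro u ⟨h0, h1⟩ ⟨-, c, hc⟩
  exact h1 (by rw [hc]; simp [h0])

theorem ncard_active_of_eigen (h : Represents q η B f) {u : V}
    (hu : u ∉ isotropicVectors η ⊤ \ eigenVectors η f) :
    {v | (u, v) ∈ activePairs η B}.ncard = 0 := by
  have : {v | (u, v) ∈ activePairs η B} = ∅ := by
    ext v
    simp only [Set.mem_ofPred_eq, Set.mem_empty_iff_false, iff_false]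
    rintro ⟨h1, h2, h3, h4⟩
    refine hu ⟨⟨trivial, h1⟩, ?_⟩
    rintro ⟨-, c, hc⟩
    simp only at h1 h3 h4
    rw [← h.adj, hc] at h4
    simp [h3] at h4
  rw [this, Set.ncard_empty]

/-- As `B u v = η (f u) v`, the admissible `v` are the isotropic vectors of `u^⊥` not orthogonal to
`f u`. -/
theorem ncard_active_of_not_eigen (h : Represents q η B f) {n : ℕ} (hV : finrank F V = n + 4)
    {u : V} (hu : u ∈ isotropicVectors η ⊤ \ eigenVectors η f) {ρ : ℕ}
    (hρ : finrank F (Submodule.span F {u, f u} ⊓ perp η (Submodule.span F {u, f u}) :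
      Submodule F V) = ρ) :
    (q : ℤ) * {v | (u, v) ∈ activePairs η B}.ncard =
      (q ^ (2 * n + 6) + (-1) ^ n * (q - 1) * q ^ (n + 4)) -
      (q ^ (2 * n + 4) + (-1) ^ (n + ρ) * (q - 1) * q ^ (n + 2 + ρ)) := by
  have huu : η u u = 0 := hu.1.2
  have hu0 : u ≠ 0 := fun h0 => hu.2 (h0 ▸ h.zero_mem_eigenVectors)
  have hli : LinearIndependent F ![u, f u] :=
    linearIndependent_pair_of_not_smul hu0 fun c hc => hu.2 ⟨huu, c, hc⟩
  set S := Submodule.span F ({u, f u} : Set V)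
  have h1 := h.ncard_isotropicVectors_perp_singleton hV hu0 huu
  have h2 := h.ncard_isotropicVectors_perp_of_finrank_two hV (finrank_span_pair hli) hρ
  have hset : {v | (u, v) ∈ activePairs η B} =
      isotropicVectors η (perp η (F ∙ u)) \ isotropicVectors η (perp η S) := by
    ext v
    simp only [activePairs, isotropicVectors, Set.mem_ofPred_eq, Set.mem_sdiff,
      IsHermitianSpace.mem_perp_span, Set.mem_singleton_iff, forall_eq, S, Set.mem_insert_iff,
      forall_eq_or_imp, h.adj]
    tauto
  have hsub : isotropicVectors η (perp η S) ⊆ isotropicVectors η (perp η (F ∙ u)) := by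
    rintro v ⟨hv, hv'⟩
    rw [IsHermitianSpace.mem_perp_span] at hv
    refine ⟨IsHermitianSpace.mem_perp_span.2 ?_, hv'⟩
    rintro x rfl
    exact hv _ (by simp)
  have h3 := Set.ncard_sdiff_add_ncard_of_subset hsub
  rw [← hset] at h3
  rw [← h1, ← h2, ← h3]
  push_cast
  ring

/-- Because `u ⊥ f u`, the line `⟨u, f u⟩` has radical of dimension two if `f u` is isotropic and
one otherwise. In the first case the signed terms cancel; in the second they leave the correction
carried by `escapingVectors`. -/
theorem ncard_activePairs (h : Represents q η B f) {n : ℕ} (hV : finrank F V = n + 4) :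
    ((activePairs η B).ncard : ℤ) = (q ^ 2 - 1) *
      (q ^ (2 * n + 3) * ((isotropicVectors η ⊤).ncard - (eigenVectors η f).ncard) +
        (-1) ^ n * q ^ (n + 2) * (escapingVectors η f).ncard) := by
  classical
  have := Fintype.ofFinite V
  have hq : (q : ℤ) ≠ 0 := by have := h.two_le; omega
  have hsub : eigenVectors η f ⊆ isotropicVectors η ⊤ := fun u hu => ⟨trivial, hu.1⟩
  have hdiff := Set.ncard_sdiff_add_ncard_of_subset hsub
  have key : ∀ u, ({v | (u, v) ∈ activePairs η B}.ncard : ℤ) =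
      (if u ∈ isotropicVectors η ⊤ \ eigenVectors η f then
        ((q : ℤ) ^ 2 - 1) * q ^ (2 * n + 3) else 0) +
      (if u ∈ escapingVectors η f then (q ^ 2 - 1) * ((-1) ^ n * (q : ℤ) ^ (n + 2)) else 0) := by
    intro u
    by_cases hu : u ∈ isotropicVectors η ⊤ \ eigenVectors η f
    · have huu : η u u = 0 := hu.1.2
      have hu0 : u ≠ 0 := fun h0 => hu.2 (h0 ▸ h.zero_mem_eigenVectors)
      have hli : LinearIndependent F ![u, f u] :=
        linearIndependent_pair_of_not_smul hu0 fun c hc => hu.2 ⟨huu, c, hc⟩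
      rw [if_pos hu]
      refine mul_left_cancel₀ hq ?_
      by_cases hfu : η (f u) (f u) = 0
      · rw [if_neg (fun h' => h'.2 hfu), h.ncard_active_of_not_eigen hV hu
          (h.finrank_rad_pair_isotropic hli huu (h.self_map u) hfu)]
        ring
      · rw [if_pos ⟨huu, hfu⟩, h.ncard_active_of_not_eigen hV hu
          (ρ := 1) (by rw [h.rad_pair_anisotropic huu (h.self_map u) hfu,
            finrank_span_singleton hu0])]
        ring
    · rw [if_neg hu, if_neg, h.ncard_active_of_eigen hu]
      · simp
      · intro h'
        exact hu ⟨⟨trivial, h'.1⟩, Set.disjoint_left.1 disjoint_escaping_eigen h'⟩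
  have h1 := ncard_pairs_eq_sum (fun u v => (u, v) ∈ activePairs η B)
  have h2 : {p : V × V | (p.1, p.2) ∈ activePairs η B} = activePairs η B := by ext; rfl
  rw [h2] at h1
  rw [h1]
  push_cast
  simp_rw [key]
  rw [Finset.sum_add_distrib, sum_ite_mem_eq_ncard_mul, sum_ite_mem_eq_ncard_mul, ← hdiff]
  push_cast
  ring

end Represents

theorem ncard_pairs_le {α β : Type*} [Finite α] [Finite β] (r : α → β → Prop)
    (S : Set α) (c : ℕ) (h : ∀ a ∈ S, {b | r a b}.ncard ≤ c)
    (h0 : ∀ a ∉ S, ∀ b, ¬ r a b) :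
    {p : α × β | r p.1 p.2}.ncard ≤ S.ncard * c := by
  classical
  have := Fintype.ofFinite α
  have h1 : ∀ a, ({b | r a b}.ncard : ℤ) ≤ if a ∈ S then (c : ℤ) else 0 := by
    intro a
    split_ifs with ha
    · exact_mod_cast h a ha
    · have : {b | r a b} = ∅ := by ext b; simpa using h0 a ha b
      rw [this]; simp
  zify
  rw [ncard_pairs_eq_sum, ← sum_ite_mem_eq_ncard_mul S c]
  push_cast
  exact Finset.sum_le_sum fun a _ => h1 a

/-! ### Upper bounds for the number of eigenvectors. -/

namespace Represents

variable {q : ℕ} {η : V →ₛₗ[σ] V →ₗ[F] F} {B : V →ₗ[F] V →ₗ[F] F} {f : V → V}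
variable [Finite F] [Finite V]

/-- The fixed vectors of a semilinear map, up to a scalar `c`, form a Baer-type subset of any
subspace that contains them. -/
theorem ncard_fixed_le (h : Represents q η B f) {c : F} (hc : c ≠ 0) {W : Submodule F V}
    (hW : ∀ u, f u = c • u → u ∈ W) : {u | f u = c • u}.ncard ≤ q ^ finrank F W := by
  obtain ⟨θ, hθ⟩ := h.exists_not_fixed
  -- Applying `f` and dividing by `c` replaces `θ` by `σ θ ≠ θ`, so `u + θ v` determines both `u`
  -- and `v`. The square of the number of solutions is therefore at most the size of `W`.
  have hinj : Set.InjOn (fun p : V × V => p.1 + θ • p.2)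
      ({u | f u = c • u} ×ˢ {u | f u = c • u}) := by
    rintro ⟨u, v⟩ ⟨hu, hv⟩ ⟨u', v'⟩ ⟨hu', hv'⟩ heq
    simp only [Set.mem_ofPred_eq] at hu hv hu' hv' heq
    have h1 := congrArg f heq
    rw [h.map_add, h.map_add, h.map_smul, h.map_smul, hu, hv, hu', hv', smul_comm (σ θ) c,
      smul_comm (σ θ) c, ← smul_add, ← smul_add] at h1
    have h2 := smul_right_injective V hc h1
    have h3 : (θ - σ θ) • (v - v') = 0 := by
      have : (u + θ • v) - (u + σ θ • v) = (u' + θ • v') - (u' + σ θ • v') := by rw [heq, h2]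
      rw [add_sub_add_left_eq_sub, add_sub_add_left_eq_sub, ← sub_smul, ← sub_smul] at this
      rw [smul_sub, this, sub_self]
    have h4 : v = v' :=
      sub_eq_zero.1 ((smul_eq_zero.1 h3).resolve_left (sub_ne_zero.2 (Ne.symm hθ)))
    subst h4
    simpa using heq
  have hsub : (fun p : V × V => p.1 + θ • p.2) '' ({u | f u = c • u} ×ˢ {u | f u = c • u}) ⊆
      (W : Set V) := by
    rintro _ ⟨⟨u, v⟩, ⟨hu, hv⟩, rfl⟩
    exact W.add_mem (hW u hu) (W.smul_mem _ (hW v hv))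
  have h1 := Set.ncard_le_ncard hsub
  rw [hinj.ncard_image, Set.ncard_prod, h.ncard_submodule, two_mul, pow_add] at h1
  exact Nat.mul_self_le_mul_self_iff.1 h1

theorem mem_perp_ker_of_fixed (h : Represents q η B f) {c : F} (hc : c ≠ 0) {u : V}
    (hu : f u = c • u) : u ∈ perp η (LinearMap.ker B) := by
  have h1 : u = c⁻¹ • f u := by rw [hu, smul_smul, inv_mul_cancel₀ hc, one_smul]
  rw [h1]
  exact Submodule.smul_mem _ _ (h.map_mem_perp_ker u)

/-- The square of the semilinear map `f`, as a linear map. -/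
def square (h : Represents q η B f) : V →ₗ[F] V where
  toFun u := f (f u)
  map_add' u v := by rw [h.map_add, h.map_add]
  map_smul' a u := by rw [h.map_smul, h.map_smul, h.star_star, RingHom.id_apply]

/-- The eigenspaces of the square of `f`. -/
def squareEigenspace (h : Represents q η B f) (t : F) : Submodule F V :=
  LinearMap.ker (h.square - t • LinearMap.id)

theorem mem_squareEigenspace (h : Represents q η B f) {t : F} {u : V} :
    u ∈ h.squareEigenspace t ↔ f (f u) = t • u := by
  rw [squareEigenspace, LinearMap.mem_ker, LinearMap.sub_apply, sub_eq_zero]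
  rfl

theorem mem_squareEigenspace_of_fixed (h : Represents q η B f) {c : F} {u : V}
    (hu : f u = c • u) : u ∈ h.squareEigenspace (σ c * c) := by
  rw [mem_squareEigenspace, hu, h.map_smul, hu, smul_smul]

/-- Eigenvectors with eigenvalue zero form the isotropic part of `ker B`; the others are sorted by
an eigenvalue in `C`, with the zero vector removed from each class. -/
theorem ncard_eigenVectors_le (h : Represents q η B f) (C : Set F) (K : ℕ)
    (hC : ∀ u ≠ 0, ∀ c : F, c ≠ 0 → f u = c • u → c ∈ C)
    (hK : ∀ c : F, c ≠ 0 → {u | f u = c • u}.ncard ≤ K) (h0 : 0 ∉ C) :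
    (eigenVectors η f).ncard ≤
      (isotropicVectors η (LinearMap.ker B)).ncard + C.ncard * (K - 1) := by
  have h1 := ncard_pairs_le (fun (c : F) (u : V) => c ∈ C ∧ u ≠ 0 ∧ f u = c • u) C (K - 1)
    (fun c hc => by
      have h2 : {u : V | c ∈ C ∧ u ≠ 0 ∧ f u = c • u} = {u | f u = c • u} \ {0} := by
        ext u
        simp [hc, and_comm]
      have h3 : (0 : V) ∈ {u | f u = c • u} := by simp [h.map_zero]
      rw [h2, Set.ncard_sdiff_singleton_of_mem h3]
      exact Nat.sub_le_sub_right (hK c (fun hc0 => h0 (hc0 ▸ hc))) 1)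
    (fun c hc u hu => hc hu.1)
  have hsub : eigenVectors η f ⊆ isotropicVectors η (LinearMap.ker B) ∪
      Prod.snd '' {p : F × V | p.1 ∈ C ∧ p.2 ≠ 0 ∧ f p.2 = p.1 • p.2} := by
    rintro u ⟨huu, c, hc⟩
    by_cases hk : f u = 0
    · exact Or.inl ⟨h.map_eq_zero_iff.1 hk, huu⟩
    · have hc0 : c ≠ 0 := by rintro rfl; exact hk (by rw [hc, zero_smul])
      have hu0 : u ≠ 0 := by rintro rfl; exact hk h.map_zero
      exact Or.inr ⟨(c, u), ⟨hC u hu0 c hc0 hc, hu0, hc⟩, rfl⟩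
  refine (Set.ncard_le_ncard hsub).trans ((Set.ncard_union_le _ _).trans ?_)
  exact Nat.add_le_add_left ((Set.ncard_image_le).trans h1) _

theorem ncard_eigenVectors_le_of_fixed_le (h : Represents q η B f) {k : ℕ}
    (hk : ∀ c : F, c ≠ 0 → {u | f u = c • u}.ncard ≤ q ^ k) :
    ((eigenVectors η f).ncard : ℤ) ≤
      (isotropicVectors η (LinearMap.ker B)).ncard + (q ^ 2 - 1) * (q ^ k - 1) := by
  have h1 := h.ncard_eigenVectors_le {c | c ≠ 0} (q ^ k) (fun u _ c hc _ => hc) hk (by simp)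
  have h2 : {c : F | c ≠ 0}.ncard = q ^ 2 - 1 := by
    have : {c : F | c ≠ 0} = Set.univ \ {0} := by ext; simp
    rw [this, Set.ncard_sdiff_singleton_of_mem (Set.mem_univ _), Set.ncard_univ, h.card_eq]
  have hq : 1 ≤ q := by have := h.two_le; omega
  have h3 := Nat.one_le_pow 2 q hq
  have h4 := Nat.one_le_pow k q hq
  rw [h2] at h1
  zify [h3, h4] at h1
  exact h1

/-- From `f u = c u` follows `f (f u) = σ c * c • u`, so only the at most `q + 1` scalars of norm
`t` are eigenvalues. -/
theorem ncard_eigenVectors_le_of_square (h : Represents q η B f) {k : ℕ} {t : F} (ht : t ≠ 0)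
    (hk : ∀ c : F, c ≠ 0 → {u | f u = c • u}.ncard ≤ q ^ k)
    (hsq : ∀ u ∈ perp η (LinearMap.ker B), f (f u) = t • u) :
    ((eigenVectors η f).ncard : ℤ) ≤
      (isotropicVectors η (LinearMap.ker B)).ncard + (q + 1) * (q ^ k - 1) := by
  have h1 := h.ncard_eigenVectors_le {c | σ c * c = t} (q ^ k) (fun u hu c hc huc => by
    have h2 := hsq u (h.mem_perp_ker_of_fixed hc huc)
    rw [huc, h.map_smul, huc, smul_smul] at h2
    exact smul_left_injective F hu h2) hk (by simp [ht.symm])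
  have hq : 1 ≤ q := by have := h.two_le; omega
  have h4 := Nat.one_le_pow k q hq
  have h5 := h1.trans (Nat.add_le_add_left (Nat.mul_le_mul_right _ (h.ncard_norm_fiber_le t)) _)
  zify [h4] at h5
  exact h5

theorem fixed_le_perp_ker (h : Represents q η B f) (c : F) (hc : c ≠ 0) :
    {u | f u = c • u}.ncard ≤ q ^ finrank F (perp η (LinearMap.ker B)) :=
  h.ncard_fixed_le hc fun _ hu => h.mem_perp_ker_of_fixed hc hu

theorem ncard_isotropic_le (h : Represents q η B f) (W : Submodule F V) :
    (isotropicVectors η W).ncard ≤ q ^ (2 * finrank F W) := by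
  rw [← h.ncard_submodule]
  exact Set.ncard_le_ncard fun x hx => hx.1

theorem ncard_eigenVectors_le_crude (h : Represents q η B f) :
    ((eigenVectors η f).ncard : ℤ) ≤ q ^ (2 * finrank F (LinearMap.ker B)) +
      (q ^ 2 - 1) * (q ^ finrank F (perp η (LinearMap.ker B)) - 1) := by
  have h1 := h.ncard_eigenVectors_le_of_fixed_le h.fixed_le_perp_ker
  have h2 := h.ncard_isotropic_le (LinearMap.ker B)
  zify at h2
  linarith

/-- Either each of the `q^2 - 1` nonzero scalars has at most `q^k` solutions, or some scalar has
more. In the latter case an eigenspace of `f²` is all of `V`, and at most `q + 1` eigenvalues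
remain. The second alternative gives the larger bound. -/
theorem ncard_eigenVectors_le_of_ker_eq_bot (h : Represents q η B f) {k : ℕ}
    (hV : finrank F V = k + 1) (hB : LinearMap.ker B = ⊥) :
    ((eigenVectors η f).ncard : ℤ) ≤ 1 + (q + 1) * (q ^ (k + 1) - 1) := by
  have hq : 2 ≤ (q : ℤ) := by exact_mod_cast h.two_le
  have hiso : (isotropicVectors η (LinearMap.ker B)).ncard ≤ 1 := by
    have := h.ncard_isotropic_le (LinearMap.ker B)
    rwa [hB, finrank_bot, mul_zero, pow_zero, ← hB] at this
  have hL : finrank F (perp η (LinearMap.ker B)) = k + 1 := by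
    have := h.finrank_perp (LinearMap.ker B)
    rw [hB, finrank_bot, ← hB] at this
    omega
  zify at hiso
  by_cases hc : ∃ c : F, c ≠ 0 ∧ q ^ k < {u | f u = c • u}.ncard
  · obtain ⟨c, hc, hck⟩ := hc
    have h1 := h.ncard_fixed_le hc (W := h.squareEigenspace (σ c * c))
      fun u hu => h.mem_squareEigenspace_of_fixed hu
    have h2 := (Nat.pow_lt_pow_iff_right (by have := h.two_le; omega)).1 (hck.trans_le h1)
    have h3 : h.squareEigenspace (σ c * c) = ⊤ :=
      Submodule.eq_top_of_finrank_eq (le_antisymm (Submodule.finrank_le _) (by omega))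
    have h4 := h.ncard_eigenVectors_le_of_square (t := σ c * c) (k := k + 1)
      (mul_ne_zero ((map_ne_zero σ).2 hc) hc)
      (fun c hc => by have := h.fixed_le_perp_ker c hc; rwa [hL] at this)
      (fun u _ => h.mem_squareEigenspace.1 (h3 ▸ Submodule.mem_top))
    linarith
  · push Not at hc
    have h1 := h.ncard_eigenVectors_le_of_fixed_le hc
    have h2 : (1 : ℤ) ≤ q ^ k := one_le_pow₀ (by linarith)
    have h3 : (1 : ℤ) + (q + 1) * (q ^ (k + 1) - 1) - (1 + (q ^ 2 - 1) * (q ^ k - 1)) =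
      (q + 1) * (q ^ k + q - 2) := by ring
    nlinarith

end Represents

/-- The normalized number of pairs of vectors spanning a totally isotropic line on which the
alternating form represented by `f` does not vanish, for `V` of dimension `n + 4`. -/
noncomputable def weightSum (η : V →ₛₗ[σ] V →ₗ[F] F) (f : V → V) (q n : ℕ) : ℤ :=
  q ^ (2 * n + 1) * ((isotropicVectors η ⊤).ncard - (eigenVectors η f).ncard) +
    (-1) ^ n * q ^ n * (escapingVectors η f).ncard

theorem IsHermitianSpace.ncard_isotropic_top [Finite F] [Finite V] {q : ℕ}
    {η : V →ₛₗ[σ] V →ₗ[F] F} (h : IsHermitianSpace q η) {n : ℕ} (hV : finrank F V = n + 4) :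
    ((isotropicVectors η ⊤).ncard : ℤ) = q ^ (2 * n + 7) + (-1) ^ n * (q - 1) * q ^ (n + 3) := by
  have hq : (q : ℤ) ≠ 0 := by have := h.two_le; omega
  refine mul_left_cancel₀ hq ?_
  rw [h.ncard_isotropicVectors_top, hV]
  ring

/-! ### Lower bounds for the weight from bounds on eigenvectors. -/

namespace Represents

variable {q : ℕ} {η : V →ₛₗ[σ] V →ₗ[F] F} {B : V →ₗ[F] V →ₗ[F] F} {f : V → V}
variable [Finite F] [Finite V]

theorem ncard_activePairs_eq (h : Represents q η B f) {n : ℕ} (hV : finrank F V = n + 4) :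
    ((activePairs η B).ncard : ℤ) = (q ^ 2 - 1) * q ^ 2 * weightSum η f q n := by
  rw [h.ncard_activePairs hV, weightSum]
  ring

theorem escaping_add_eigen_le (η : V →ₛₗ[σ] V →ₗ[F] F) (f : V → V) :
    (escapingVectors η f).ncard + (eigenVectors η f).ncard ≤ (isotropicVectors η ⊤).ncard := by
  rw [← Set.ncard_union_eq disjoint_escaping_eigen]
  refine Set.ncard_le_ncard ?_
  rintro u (hu | hu) <;> exact ⟨trivial, hu.1⟩

/-- For even `n` the escaping vectors only add to the weight and are dropped. -/
theorem weightSum_ge_of_even (h : Represents q η B f) {n : ℕ} (hV : finrank F V = n + 4)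
    (hn : Even n) {E : ℤ} (hE : ((eigenVectors η f).ncard : ℤ) ≤ E) :
    (q : ℤ) ^ (2 * n + 1) * (q ^ (2 * n + 7) + (q - 1) * q ^ (n + 3) - E) ≤ weightSum η f q n := by
  rw [weightSum, h.ncard_isotropic_top hV, hn.neg_one_pow, one_mul, one_mul]
  have h1 : (0 : ℤ) ≤ q ^ n * (escapingVectors η f).ncard := by positivity
  have h2 : (0 : ℤ) ≤ q ^ (2 * n + 1) := by positivity
  have := mul_le_mul_of_nonneg_left hE h2
  linarith

theorem weightSum_ge_of_odd (h : Represents q η B f) {n : ℕ} (hV : finrank F V = n + 4)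
    (hn : Odd n) {E D : ℤ} (hE : ((eigenVectors η f).ncard : ℤ) ≤ E)
    (hD : ((escapingVectors η f).ncard : ℤ) ≤ D) :
    (q : ℤ) ^ (2 * n + 1) * (q ^ (2 * n + 7) - (q - 1) * q ^ (n + 3) - E) - q ^ n * D ≤
      weightSum η f q n := by
  rw [weightSum, h.ncard_isotropic_top hV, hn.neg_one_pow]
  have h1 : (0 : ℤ) ≤ q ^ n := by positivity
  have h2 : (0 : ℤ) ≤ q ^ (2 * n + 1) := by positivity
  have := mul_le_mul_of_nonneg_left hE h2
  have := mul_le_mul_of_nonneg_left hD h1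
  linarith

/-- With few eigenvectors, the weight is large. -/
theorem weightSum_ge_of_eigen_le (h : Represents q η B f) {n : ℕ} (hV : finrank F V = n + 4)
    (hE : ((eigenVectors η f).ncard : ℤ) ≤ q ^ (2 * n + 3) + (-1) ^ n * (q - 1) * q ^ (n + 3)) :
    (if Even n then (q : ℤ) ^ (4 * n + 4) else q ^ (4 * n + 4) - q ^ (3 * n + 3)) * (q ^ 4 - 1) ≤
      weightSum η f q n := by
  split_ifs with hn
  -- The threshold in `hE` is the number of isotropic vectors orthogonal to a totally isotropic
  -- line; for even `n` it gives the bound exactly.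
  · refine le_trans (le_of_eq ?_) (h.weightSum_ge_of_even hV hn hE)
    rw [hn.neg_one_pow]
    ring
  · rw [Nat.not_even_iff_odd] at hn
    -- For odd `n`, `D ≤ I - E` bounds the weight below by `(q^(2n+1) - q^n) (I - E)`.
    have h1 := escaping_add_eigen_le η f
    zify at h1
    have h2 := h.ncard_isotropic_top hV
    rw [hn.neg_one_pow] at h2 hE
    rw [weightSum, hn.neg_one_pow]
    have hq : (1 : ℤ) ≤ q := by have := h.two_le; omega
    have h3 : (0 : ℤ) ≤ q ^ n := by positivity
    have h4 : (q : ℤ) ^ n ≤ q ^ (2 * n + 1) := pow_le_pow_right₀ hq (by omega)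
    have h5 : (q : ℤ) ^ (2 * n + 3) * (q ^ 4 - 1) ≤
        (isotropicVectors η ⊤).ncard - (eigenVectors η f).ncard := by
      refine le_trans (le_of_eq ?_) (sub_le_sub_left hE _)
      rw [h2]
      ring
    calc ((q : ℤ) ^ (4 * n + 4) - q ^ (3 * n + 3)) * (q ^ 4 - 1)
        = ((q : ℤ) ^ (2 * n + 1) - q ^ n) * (q ^ (2 * n + 3) * (q ^ 4 - 1)) := by ring
      _ ≤ ((q : ℤ) ^ (2 * n + 1) - q ^ n) *
          (((isotropicVectors η ⊤).ncard : ℤ) - (eigenVectors η f).ncard) :=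
        mul_le_mul_of_nonneg_left h5 (by linarith)
      _ ≤ _ := by nlinarith [mul_le_mul_of_nonneg_left h1 h3]

/-- Forms of rank at least four, dimension at least seven. -/
theorem weightSum_ge_of_rank_ge_four (h : Represents q η B f) {n : ℕ} (hV : finrank F V = n + 4)
    (hn : 3 ≤ n) (hr : 4 ≤ finrank F (perp η (LinearMap.ker B))) :
    (if Even n then (q : ℤ) ^ (4 * n + 4) else q ^ (4 * n + 4) - q ^ (3 * n + 3)) * (q ^ 4 - 1) ≤
      weightSum η f q n := by
  refine h.weightSum_ge_of_eigen_le hV (h.ncard_eigenVectors_le_crude.trans ?_)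
  have hq : (2 : ℤ) ≤ q := by exact_mod_cast h.two_le
  have hdim := h.finrank_perp (LinearMap.ker B)
  have h1 : (q : ℤ) ^ (2 * finrank F (LinearMap.ker B)) ≤ q ^ (2 * n) :=
    pow_le_pow_right₀ (by linarith) (by omega)
  have h2 : (q : ℤ) ^ finrank F (perp η (LinearMap.ker B)) ≤ q ^ (n + 4) :=
    pow_le_pow_right₀ (by linarith) (by omega)
  have h3 : (q : ℤ) ^ 3 ≤ q ^ n := pow_le_pow_right₀ (by linarith) hn
  have h4 : (0 : ℤ) ≤ q ^ 2 - 1 := by nlinarith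
  have h5 := mul_le_mul_of_nonneg_left h2 h4
  have h6 : -((q - 1) * (q : ℤ) ^ (n + 3)) ≤ (-1) ^ n * (q - 1) * q ^ (n + 3) := by
    have h7 : (0 : ℤ) ≤ (q - 1) * q ^ (n + 3) := mul_nonneg (by linarith) (by positivity)
    rcases neg_one_pow_eq_or ℤ n with h8 | h8 <;> rw [h8] <;> linarith
  -- The margin between the threshold and the crude bound; `n ≥ 3` is what makes it nonnegative.
  have h9 : (0 : ℤ) ≤ q ^ n * ((q ^ n - q ^ 3) * (q ^ 3 - 1)) := by
    refine mul_nonneg (by positivity) (mul_nonneg (by linarith) ?_)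
    have : (1 : ℤ) ≤ q ^ 3 := one_le_pow₀ (by linarith)
    linarith
  have h10 : (q : ℤ) ^ (2 * n + 3) - (q - 1) * (q : ℤ) ^ (n + 3) -
      (q ^ (2 * n) + (q ^ 2 - 1) * q ^ (n + 4)) = q ^ n * ((q ^ n - q ^ 3) * (q ^ 3 - 1)) := by ring
  linarith

/-! ### Forms of rank two. -/

section RankTwo

theorem perp_perp_ker (h : Represents q η B f) :
    perp η (perp η (LinearMap.ker B)) = LinearMap.ker B := h.perp_perp _

/-- Eigenvectors lie in `ker B` or in `L = (ker B)^⊥`. The overlap `L ∩ L^⊥` is totally isotropic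
and is counted only once. -/
theorem ncard_eigenVectors_le_rank_two (h : Represents q η B f) :
    (eigenVectors η f).ncard + q ^ (2 * finrank F
        (perp η (LinearMap.ker B) ⊓ perp η (perp η (LinearMap.ker B)) : Submodule F V)) ≤
      (isotropicVectors η (LinearMap.ker B)).ncard +
        (isotropicVectors η (perp η (LinearMap.ker B))).ncard := by
  set L := perp η (LinearMap.ker B) with hL
  rw [← h.ncard_submodule]
  have hsub : ((L ⊓ perp η L : Submodule F V) : Set V) ⊆ isotropicVectors η L :=
    fun x hx => ⟨hx.1, hx.2 x hx.1⟩
  have h1 := Set.ncard_sdiff_add_ncard_of_subset hsub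
  rw [← h1, ← add_assoc]
  refine Nat.add_le_add_right ?_ _
  refine (Set.ncard_le_ncard ?_).trans (Set.ncard_union_le _ _)
  rintro u ⟨huu, c, hc⟩
  by_cases hk : f u = 0
  · exact Or.inl ⟨h.map_eq_zero_iff.1 hk, huu⟩
  · have hc0 : c ≠ 0 := by rintro rfl; exact hk (by rw [hc, zero_smul])
    refine Or.inr ⟨⟨h.mem_perp_ker_of_fixed hc0 hc, huu⟩, fun hx => hk ?_⟩
    rw [h.map_eq_zero_iff, ← h.perp_perp_ker]
    exact hx.2

/-- If `f u` is not a multiple of `p`, then `p` and `f u` span `L = (ker B)^⊥`. Since `u` is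
orthogonal to both, it lies in `L^⊥ = ker B` and `f u = 0`. So escaping vectors avoid `p^⊥`. -/
theorem escaping_of_rad_one (h : Represents q η B f)
    (hL : finrank F (perp η (LinearMap.ker B)) = 2) {p : V} (hp : p ≠ 0)
    (hpL : p ∈ perp η (LinearMap.ker B)) (hpR : p ∈ LinearMap.ker B) {u : V}
    (hu : η p u = 0) : η (f u) (f u) = 0 := by
  by_cases hfu : ∃ c : F, f u = c • p
  · obtain ⟨c, hc⟩ := hfu
    simp [hc, hpL p hpR]
  · push Not at hfu
    have hli := linearIndependent_pair_of_not_smul hp hfu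
    have hspan : Submodule.span F {p, f u} = perp η (LinearMap.ker B) := by
      refine Submodule.eq_of_le_of_finrank_eq ?_ (by rw [finrank_span_pair hli, hL])
      rw [Submodule.span_le]
      rintro x (rfl | rfl)
      · exact hpL
      · exact h.map_mem_perp_ker u
    have hker : u ∈ LinearMap.ker B := by
      rw [← h.perp_perp_ker, ← hspan, IsHermitianSpace.mem_perp_span]
      rintro x (rfl | rfl)
      · exact hu
      · exact h.map_self u
    rw [h.map_eq_zero_iff.2 hker]
    simp

/-- If `f l` is not a multiple of `l`, the two span `(ker B)^⊥`, and `l`, being orthogonal to both,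
lies in the zero radical. -/
theorem map_isotropic_of_rad_zero (h : Represents q η B f)
    (hL : finrank F (perp η (LinearMap.ker B)) = 2)
    (hrad : perp η (LinearMap.ker B) ⊓ perp η (perp η (LinearMap.ker B)) = ⊥) {l : V}
    (hl : l ∈ perp η (LinearMap.ker B)) (hll : η l l = 0) : η (f l) (f l) = 0 := by
  by_cases hl0 : l = 0
  · rw [hl0, h.map_zero]; simp
  by_cases hfu : ∃ c : F, f l = c • l
  · obtain ⟨c, hc⟩ := hfu
    simp [hc, hll]
  · push Not at hfu
    have hli := linearIndependent_pair_of_not_smul hl0 hfu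
    have hspan : Submodule.span F {l, f l} = perp η (LinearMap.ker B) := by
      refine Submodule.eq_of_le_of_finrank_eq ?_ (by rw [finrank_span_pair hli, hL])
      rw [Submodule.span_le]
      rintro x (rfl | rfl)
      · exact hl
      · exact h.map_mem_perp_ker l
    exfalso
    apply hl0
    rw [← Submodule.mem_bot F, ← hrad]
    refine ⟨hl, ?_⟩
    rw [← hspan]
    refine IsHermitianSpace.mem_perp_span.2 ?_
    rintro x (rfl | rfl)
    · exact hll
    · exact h.map_self l

/-- A sum of isotropic vectors `r ∈ ker B` and `l ∈ (ker B)^⊥` is isotropic and does not escape,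
because `f (r + l) = f l`; such sums are pairwise distinct. -/
theorem ncard_escaping_add_le_of_rad_zero (h : Represents q η B f)
    (hL : finrank F (perp η (LinearMap.ker B)) = 2)
    (hrad : perp η (LinearMap.ker B) ⊓ perp η (perp η (LinearMap.ker B)) = ⊥) :
    (escapingVectors η f).ncard + (isotropicVectors η (LinearMap.ker B)).ncard *
      (isotropicVectors η (perp η (LinearMap.ker B))).ncard ≤ (isotropicVectors η ⊤).ncard := by
  set L := perp η (LinearMap.ker B) with hLdef
  have hinj : Set.InjOn (fun p : V × V => p.1 + p.2)
      (isotropicVectors η (LinearMap.ker B) ×ˢ isotropicVectors η L) := by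
    rintro ⟨r, l⟩ ⟨hr, hl⟩ ⟨r', l'⟩ ⟨hr', hl'⟩ heq
    simp only at hr hl hr' hl' heq
    have h1 : l - l' = r' - r := by
      rw [sub_eq_sub_iff_add_eq_add, add_comm l, add_comm r', heq, add_comm]
    have h2 : l - l' ∈ L ⊓ perp η L := by
      refine ⟨L.sub_mem hl.1 hl'.1, ?_⟩
      rw [h1, h.perp_perp_ker]
      exact Submodule.sub_mem _ hr'.1 hr.1
    rw [hrad, Submodule.mem_bot, sub_eq_zero] at h2
    subst h2
    simpa using heq
  rw [← Set.ncard_prod, ← hinj.ncard_image, ← Set.ncard_union_eq]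
  · refine Set.ncard_le_ncard ?_
    rintro u (hu | ⟨⟨r, l⟩, ⟨hr, hl⟩, rfl⟩)
    · exact ⟨trivial, hu.1⟩
    · refine ⟨trivial, ?_⟩
      have h1 : η r l = 0 := hl.1 r hr.1
      simp [hr.2, hl.2, h1, h.isRefl h1]
  · rw [Set.disjoint_left]
    rintro _ hu ⟨⟨r, l⟩, ⟨hr, hl⟩, rfl⟩
    refine hu.2 ?_
    simp only
    rw [h.map_add, h.map_eq_zero_iff.2 hr.1, zero_add]
    exact h.map_isotropic_of_rad_zero hL hrad hl.1 hl.2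

/-- The line `(ker B)^⊥` is nondegenerate, tangent or totally isotropic (`ρ = 0, 1, 2`). The
eigenvector threshold is met for `ρ = 2` and for even `n`; the remaining odd cases need a bound on
escaping vectors. For odd `n` the tangent case gives equality. -/
theorem weightSum_ge_of_rank_two (h : Represents q η B f) {n : ℕ} (hV : finrank F V = n + 4)
    (hn : 1 ≤ n) (hL : finrank F (perp η (LinearMap.ker B)) = 2) :
    (if Even n then (q : ℤ) ^ (4 * n + 4) else q ^ (4 * n + 4) - q ^ (3 * n + 3)) * (q ^ 4 - 1) ≤
      weightSum η f q n := by
  have hq : (2 : ℤ) ≤ q := by exact_mod_cast h.two_le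
  have hq0 : (q : ℤ) ≠ 0 := by linarith
  have hE := h.ncard_eigenVectors_le_rank_two
  have hD := h.ncard_escaping_add_le_of_rad_zero hL
  have hone := fun p h1 h2 h3 u h4 => h.escaping_of_rad_one hL (p := p) h1 h2 h3 (u := u) h4
  have hIR := fun ρ hρ => h.ncard_isotropicVectors_perp_of_finrank_two hV hL (ρ := ρ) hρ
  have hIL := h.ncard_isotropicVectors (perp η (LinearMap.ker B))
  have hperp := h.perp_perp_ker
  have hI := h.ncard_isotropic_top hV
  rw [hperp] at hE hD hIR hIL
  rw [hL] at hIL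
  have hρ2 : finrank F (perp η (LinearMap.ker B) ⊓ LinearMap.ker B : Submodule F V) ≤ 2 :=
    hL ▸ Submodule.finrank_mono inf_le_left
  have hq2 : (0 : ℤ) ≤ q ^ 2 - 1 := by nlinarith
  generalize hρ : finrank F (perp η (LinearMap.ker B) ⊓ LinearMap.ker B : Submodule F V) = ρ at *
  specialize hIR ρ rfl
  set L := perp η (LinearMap.ker B) with hLdef
  set R := LinearMap.ker B with hR
  zify at hE
  interval_cases ρ
  · have hIR' : ((isotropicVectors η R).ncard : ℤ) =
        q ^ (2 * n + 3) + (-1) ^ n * (q - 1) * q ^ (n + 1) :=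
      mul_left_cancel₀ hq0 (by rw [hIR]; ring)
    have hIL' : ((isotropicVectors η L).ncard : ℤ) = q ^ 3 + q ^ 2 - q :=
      mul_left_cancel₀ hq0 (by rw [hIL]; ring)
    rw [hIR', hIL', mul_zero, pow_zero] at hE
    by_cases he : Even n
    · refine h.weightSum_ge_of_eigen_le hV ?_
      rw [he.neg_one_pow] at hE ⊢
      have h1 : (q : ℤ) ^ 2 ≤ q ^ n := by
        refine pow_le_pow_right₀ (by linarith) ?_
        obtain ⟨k, rfl⟩ := he
        omega
      have h3 : (q : ℤ) + 1 ≤ (q - 1) * q ^ 3 := by nlinarith [sq_nonneg ((q : ℤ) - 1)]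
      have h4 : (q : ℤ) + 1 ≤ q * q ^ n * (q - 1) := by
        nlinarith [mul_le_mul_of_nonneg_left h1 (by nlinarith : (0 : ℤ) ≤ q * (q - 1))]
      have h5 := mul_le_mul_of_nonneg_left h4 hq2
      have h6 : ((q : ℤ) ^ (2 * n + 3) + 1 * (q - 1) * q ^ (n + 3)) -
        (q ^ (2 * n + 3) + 1 * (q - 1) * q ^ (n + 1)) =
        (q ^ 2 - 1) * (q * q ^ n * (q - 1)) := by ring
      linarith
    · rw [if_neg he]
      rw [Nat.not_even_iff_odd] at he
      have hbot : L ⊓ R = ⊥ := Submodule.finrank_eq_zero.1 hρ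
      have hD' := hD hbot
      zify at hD'
      rw [hIR', hIL', hI] at hD'
      rw [he.neg_one_pow] at hD' hE
      have h1 := h.weightSum_ge_of_odd hV he (E := q ^ (2 * n + 3) + (-1) * (q - 1) * q ^ (n + 1)
        + (q ^ 3 + q ^ 2 - q) - 1) (by linarith) (le_sub_iff_add_le.2 hD')
      refine le_trans (sub_nonneg.1 ?_) h1
      have h2 : (1 : ℤ) ≤ q ^ n := one_le_pow₀ (by linarith)
      have h3 : (0 : ℤ) ≤ q * q ^ n - 1 := by nlinarith
      have h4 : (0 : ℤ) ≤ q ^ 4 - 1 := by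
        have : (1 : ℤ) ≤ q ^ 4 := one_le_pow₀ (by linarith)
        linarith
      have h5 : (0 : ℤ) ≤ q ^ n * q ^ n * q * (q ^ 4 - 1) * (q * q ^ n - 1) := by positivity
      refine h5.trans (le_of_eq ?_)
      ring
  · have hIR' : ((isotropicVectors η R).ncard : ℤ) =
        q ^ (2 * n + 3) - (-1) ^ n * (q - 1) * q ^ (n + 2) :=
      mul_left_cancel₀ hq0 (by rw [hIR]; ring)
    have hIL' : ((isotropicVectors η L).ncard : ℤ) = q ^ 2 :=
      mul_left_cancel₀ hq0 (by rw [hIL]; ring)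
    rw [hIR', hIL', mul_one] at hE
    by_cases he : Even n
    · refine h.weightSum_ge_of_eigen_le hV ?_
      rw [he.neg_one_pow] at hE ⊢
      have h1 : (0 : ℤ) ≤ (q - 1) * q ^ (n + 2) := mul_nonneg (by linarith) (by positivity)
      have h2 : (0 : ℤ) ≤ (q - 1) * q ^ (n + 3) := mul_nonneg (by linarith) (by positivity)
      linarith
    · rw [if_neg he]
      rw [Nat.not_even_iff_odd] at he
      obtain ⟨⟨p, hpL, hpR⟩, hp0⟩ := finrank_pos_iff_exists_ne_zero.1 (hρ.symm ▸ one_pos)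
      have hp : p ≠ 0 := fun h0 => hp0 (Subtype.ext h0)
      have hsub : isotropicVectors η (perp η (F ∙ p)) ⊆ isotropicVectors η ⊤ :=
        fun u hu => ⟨trivial, hu.2⟩
      have h1 : (escapingVectors η f).ncard ≤
          (isotropicVectors η ⊤ \ isotropicVectors η (perp η (F ∙ p))).ncard := by
        refine Set.ncard_le_ncard fun u hu => ⟨⟨trivial, hu.1⟩, fun hu' => hu.2 ?_⟩
        exact hone p hp hpL hpR u (hu'.1 p (Submodule.mem_span_singleton_self p))
      have h2 := Set.ncard_sdiff_add_ncard_of_subset hsub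
      have h3 := h.ncard_isotropicVectors_perp_singleton hV hp (hpL p hpR)
      have h3' : ((isotropicVectors η (perp η (F ∙ p))).ncard : ℤ) =
          q ^ (2 * n + 5) + (-1) ^ n * (q - 1) * q ^ (n + 3) :=
        mul_left_cancel₀ hq0 (by rw [h3]; ring)
      zify at h1 h2
      rw [h3', hI] at h2
      rw [he.neg_one_pow] at h2 hE
      have h4 := h.weightSum_ge_of_odd hV he (E := q ^ (2 * n + 3) + (q - 1) * q ^ (n + 2))
        (D := q ^ (2 * n + 5) * (q ^ 2 - 1)) (by linarith)
        (by refine h1.trans (le_of_eq ?_); linear_combination h2)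
      refine le_trans (le_of_eq ?_) h4
      ring
  · refine h.weightSum_ge_of_eigen_le hV ?_
    have hIR' : ((isotropicVectors η R).ncard : ℤ) =
        q ^ (2 * n + 3) + (-1) ^ n * (q - 1) * q ^ (n + 3) :=
      mul_left_cancel₀ hq0 (by rw [hIR]; ring)
    have hIL' : ((isotropicVectors η L).ncard : ℤ) = q ^ 4 :=
      mul_left_cancel₀ hq0 (by rw [hIL]; ring)
    rw [hIR', hIL', show 2 * 2 = 4 from rfl] at hE
    linarith

end RankTwo

end Represents

/-- The minimum distance of the line Hermitian Grassmann code of a space of dimension `n + 4`. -/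
def minDist (q n : ℕ) : ℤ :=
  if n = 0 ∨ n = 2 then q ^ (4 * n + 4) - q ^ (2 * n + 2)
  else if Even n then q ^ (4 * n + 4) else q ^ (4 * n + 4) - q ^ (3 * n + 3)

/-! ### Dimensions four, five and six, and the general lower bound. -/

namespace Represents

variable {q : ℕ} {η : V →ₛₗ[σ] V →ₗ[F] F} {B : V →ₗ[F] V →ₗ[F] F} {f : V → V}
variable [Finite F] [Finite V]

/-- The right-hand side is the number of eigenvectors when `f² = -1`; rank two stays below it by the
crude bound. -/
theorem eigen_le_of_dim_four (h : Represents q η B f) (hV : finrank F V = 4)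
    (hr : finrank F (perp η (LinearMap.ker B)) = 2 ∨ finrank F (perp η (LinearMap.ker B)) = 4) :
    ((eigenVectors η f).ncard : ℤ) ≤ 1 + (q + 1) * (q ^ 4 - 1) := by
  have hdim := h.finrank_perp (LinearMap.ker B)
  have hq : (2 : ℤ) ≤ q := by exact_mod_cast h.two_le
  rcases hr with hr | hr
  · have h1 := h.ncard_eigenVectors_le_crude
    rw [hr, show finrank F (LinearMap.ker B) = 2 by omega] at h1
    refine h1.trans ?_
    have h3 : (1 : ℤ) + (q + 1) * (q ^ 4 - 1) - (q ^ (2 * 2) + (q ^ 2 - 1) * (q ^ 2 - 1)) =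
      (q - 1) * (q ^ 4 + (2 * q + 1)) := by ring
    have h4 : (0 : ℤ) ≤ (q - 1) * (q ^ 4 + (2 * q + 1)) :=
      mul_nonneg (by linarith) (by positivity)
    linarith
  · exact h.ncard_eigenVectors_le_of_ker_eq_bot (k := 3) hV
      (Submodule.finrank_eq_zero.1 (by omega))

/-- Rank two is left out because the crude bound is too weak there; `weightSum_ge_of_rank_two`
covers it. -/
theorem eigen_le_of_dim_six (h : Represents q η B f) (hV : finrank F V = 6)
    (hr : finrank F (perp η (LinearMap.ker B)) = 4 ∨ finrank F (perp η (LinearMap.ker B)) = 6) :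
    ((eigenVectors η f).ncard : ℤ) ≤ 1 + (q + 1) * (q ^ 6 - 1) := by
  have hdim := h.finrank_perp (LinearMap.ker B)
  have hq : (2 : ℤ) ≤ q := by exact_mod_cast h.two_le
  rcases hr with hr | hr
  · have h1 := h.ncard_eigenVectors_le_crude
    rw [hr, show finrank F (LinearMap.ker B) = 2 by omega] at h1
    refine h1.trans ?_
    have h2 : (q : ℤ) ≤ q ^ 6 * q := by
      have : (1 : ℤ) ≤ q ^ 6 := one_le_pow₀ (by linarith)
      nlinarith
    have h3 : (1 : ℤ) + (q + 1) * (q ^ 6 - 1) - (q ^ (2 * 2) + (q ^ 2 - 1) * (q ^ 4 - 1)) =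
      (q ^ 6 * q - q) + (q ^ 2 - 1) := by ring
    nlinarith
  · exact h.ncard_eigenVectors_le_of_ker_eq_bot (k := 5) hV
      (Submodule.finrank_eq_zero.1 (by omega))

/-- The alternating form `(u, v) ↦ B ((f² - t) u) v`. -/
def shiftedForm (h : Represents q η B f) (t : F) : V →ₗ[F] V →ₗ[F] F :=
  B ∘ₗ (h.square - t • LinearMap.id)

theorem shiftedForm_apply (h : Represents q η B f) (t : F) (u : V) :
    h.shiftedForm t u = B (f (f u) - t • u) := rfl

/-- Here `B (f (f u)) u = -η (f u) (f (f u))`, and every vector is orthogonal to its image. The gain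
is that the shifted form has even rank. -/
theorem shiftedForm_self (h : Represents q η B f) (t : F) (u : V) : h.shiftedForm t u u = 0 := by
  rw [shiftedForm_apply, map_sub, LinearMap.sub_apply, _root_.map_smul, LinearMap.smul_apply,
    h.alt, h.neg_flip, ← h.adj, h.self_map]
  simp

/-- The `t`-eigenspace of `f²` has dimension at least three and meets the one-dimensional `ker B`
trivially; `shiftedForm t` vanishes on both. Its kernel thus has dimension at least four in a
five-dimensional space, and even rank makes the form zero. So `f² - t` maps into `ker B`, whence the
eigenspace has dimension at least four and fills `(ker B)^⊥`. -/
theorem square_of_large_fixed (h : Represents q η B f) (hV : finrank F V = 5)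
    (hr : finrank F (perp η (LinearMap.ker B)) = 4) {c : F} (hc : c ≠ 0)
    (hlarge : q ^ 2 < {u | f u = c • u}.ncard) :
    ∀ u ∈ perp η (LinearMap.ker B), f (f u) = (σ c * c) • u := by
  have ht : σ c * c ≠ 0 := mul_ne_zero ((map_ne_zero σ).2 hc) hc
  set t := σ c * c with htdef
  have hdim := h.finrank_perp (LinearMap.ker B)
  have h1 := h.ncard_fixed_le hc (W := h.squareEigenspace t)
    fun u hu => h.mem_squareEigenspace_of_fixed hu
  have h2 := (Nat.pow_lt_pow_iff_right (by have := h.two_le; omega)).1 (hlarge.trans_le h1)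
  have hinf : h.squareEigenspace t ⊓ LinearMap.ker B = ⊥ := by
    rw [Submodule.eq_bot_iff]
    rintro u ⟨hu1, hu2⟩
    have h3 := h.mem_squareEigenspace.1 hu1
    rw [h.map_eq_zero_iff.2 hu2, h.map_zero] at h3
    exact (smul_eq_zero.1 h3.symm).resolve_left ht
  have hsup := Submodule.finrank_sup_add_finrank_inf_eq (h.squareEigenspace t) (LinearMap.ker B)
  rw [hinf, finrank_bot] at hsup
  have hle : h.squareEigenspace t ⊔ LinearMap.ker B ≤ LinearMap.ker (h.shiftedForm t) := by
    refine sup_le (fun u hu => ?_) fun u hu => ?_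
    · rw [LinearMap.mem_ker, shiftedForm_apply, h.mem_squareEigenspace.1 hu, sub_self,
        _root_.map_zero]
    · rw [LinearMap.mem_ker, shiftedForm_apply, h.map_eq_zero_iff.2 hu, h.map_zero, zero_sub,
        map_neg, _root_.map_smul, LinearMap.mem_ker.1 hu, smul_zero, neg_zero]
  have h3 := Submodule.finrank_mono hle
  have h4 := even_finrank_add_finrank_ker (h.shiftedForm t) (h.shiftedForm_self t)
  have h5 := Submodule.finrank_le (LinearMap.ker (h.shiftedForm t))
  have h6 : LinearMap.ker (h.shiftedForm t) = ⊤ :=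
    Submodule.eq_top_of_finrank_eq (by rw [Nat.even_iff] at h4; omega)
  have h7 : LinearMap.range (h.square - t • LinearMap.id) ≤ LinearMap.ker B := by
    rintro _ ⟨u, rfl⟩
    have : u ∈ LinearMap.ker (h.shiftedForm t) := h6 ▸ Submodule.mem_top
    exact this
  have h8 := Submodule.finrank_mono h7
  have h9 := LinearMap.finrank_range_add_finrank_ker (h.square - t • LinearMap.id)
  have h10 : h.squareEigenspace t ≤ perp η (LinearMap.ker B) := by
    intro u hu
    have h11 : u = t⁻¹ • f (f u) := by
      rw [h.mem_squareEigenspace.1 hu, smul_smul, inv_mul_cancel₀ ht, one_smul]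
    rw [h11]
    exact Submodule.smul_mem _ _ (h.map_mem_perp_ker _)
  have h12 : finrank F (h.squareEigenspace t) =
    finrank F (LinearMap.ker (h.square - t • LinearMap.id)) := rfl
  have h13 := Submodule.finrank_mono h10
  have h14 := Submodule.eq_of_le_of_finrank_eq h10 (by omega)
  intro u hu
  rw [← h14] at hu
  exact h.mem_squareEigenspace.1 hu

/-- Since `f²` is scalar on `(ker B)^⊥`, isotropic vectors there do not escape. The resulting bounds
on `E` and `D` give exactly the required value. -/
theorem weightSum_ge_of_square (h : Represents q η B f) (hV : finrank F V = 5)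
    (hr : finrank F (perp η (LinearMap.ker B)) = 4) {t : F} (ht : t ≠ 0)
    (hsq : ∀ u ∈ perp η (LinearMap.ker B), f (f u) = t • u) :
    ((q : ℤ) ^ 8 - q ^ 6) * (q ^ 4 - 1) ≤ weightSum η f q 1 := by
  have hq0 : (q : ℤ) ≠ 0 := by have := h.two_le; omega
  have hE := h.ncard_eigenVectors_le_of_square ht
    (fun c hc => by have := h.fixed_le_perp_ker c hc; rwa [hr] at this) hsq
  have hdim := h.finrank_perp (LinearMap.ker B)
  have hbot : perp η (LinearMap.ker B) ⊓ LinearMap.ker B = ⊥ := by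
    rw [Submodule.eq_bot_iff]
    rintro u ⟨hu1, hu2⟩
    have h3 := hsq u hu1
    rw [h.map_eq_zero_iff.2 hu2, h.map_zero] at h3
    exact (smul_eq_zero.1 h3.symm).resolve_left ht
  have hIR := h.ncard_isotropicVectors (LinearMap.ker B)
  rw [inf_comm, hbot, finrank_bot, show finrank F (LinearMap.ker B) = 1 by omega] at hIR
  have hIR' : ((isotropicVectors η (LinearMap.ker B)).ncard : ℤ) = 1 :=
    mul_left_cancel₀ hq0 (by rw [hIR]; ring)
  have hIL := h.ncard_isotropicVectors (perp η (LinearMap.ker B))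
  rw [h.perp_perp_ker, hbot, finrank_bot, hr] at hIL
  have hIL' : ((isotropicVectors η (perp η (LinearMap.ker B))).ncard : ℤ) =
      q ^ 7 + (q - 1) * q ^ 3 := mul_left_cancel₀ hq0 (by rw [hIL]; ring)
  have hsub : isotropicVectors η (perp η (LinearMap.ker B)) ⊆ isotropicVectors η ⊤ :=
    fun u hu => ⟨trivial, hu.2⟩
  have h1 : (escapingVectors η f).ncard ≤
      (isotropicVectors η ⊤ \ isotropicVectors η (perp η (LinearMap.ker B))).ncard := by
    refine Set.ncard_le_ncard fun u hu => ⟨⟨trivial, hu.1⟩, fun hu' => hu.2 ?_⟩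
    rw [h.form_map_map, hsq u hu'.1, map_smulₛₗ, LinearMap.smul_apply, hu.1, smul_zero, neg_zero]
  have h2 := Set.ncard_sdiff_add_ncard_of_subset hsub
  have hI := h.ncard_isotropic_top (n := 1) hV
  zify at h1 h2
  rw [hIL', hI] at h2
  have h4 := h.weightSum_ge_of_odd (n := 1) hV odd_one hE
    (D := q ^ 9 - (q - 1) * q ^ 4 - (q ^ 7 + (q - 1) * q ^ 3))
    (by refine h1.trans (le_of_eq ?_); linear_combination h2)
  rw [hIR'] at h4
  refine le_trans (le_of_eq ?_) h4
  ring

theorem weightSum_ge_of_dim_five (h : Represents q η B f) (hV : finrank F V = 5)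
    (hr : finrank F (perp η (LinearMap.ker B)) = 4) :
    ((q : ℤ) ^ 8 - q ^ 6) * (q ^ 4 - 1) ≤ weightSum η f q 1 := by
  by_cases hc : ∃ c : F, c ≠ 0 ∧ q ^ 2 < {u | f u = c • u}.ncard
  · obtain ⟨c, hc, hlarge⟩ := hc
    exact h.weightSum_ge_of_square hV hr (mul_ne_zero ((map_ne_zero σ).2 hc) hc)
      (h.square_of_large_fixed hV hr hc hlarge)
  · push Not at hc
    have hdim := h.finrank_perp (LinearMap.ker B)
    have h1 := h.ncard_eigenVectors_le_of_fixed_le hc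
    have h2 := h.ncard_isotropic_le (LinearMap.ker B)
    rw [show finrank F (LinearMap.ker B) = 1 by omega] at h2
    zify at h2
    have hq : (2 : ℤ) ≤ q := by exact_mod_cast h.two_le
    have h3 := h.weightSum_ge_of_eigen_le (n := 1) hV (by
      have h4 : (1 : ℤ) ≤ q ^ 2 := one_le_pow₀ (by linarith)
      have h5 : (q : ℤ) ^ (2 * 1 + 3) + (-1) ^ 1 * (q - 1) * q ^ (1 + 3) -
        (q ^ (2 * 1) + (q ^ 2 - 1) * (q ^ 2 - 1)) = q ^ 2 - 1 := by ring
      linarith)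
    simpa using h3

/-- The rank is even and nonzero, which leaves rank two and rank at least four in each dimension. -/
theorem weightSum_ge (h : Represents q η B f) {n : ℕ} (hV : finrank F V = n + 4) (hB : B ≠ 0) :
    minDist q n * (q ^ 4 - 1) ≤ weightSum η f q n := by
  have hq : (2 : ℤ) ≤ q := by exact_mod_cast h.two_le
  have hdim := h.finrank_perp (LinearMap.ker B)
  have heven := even_finrank_add_finrank_ker B h.alt
  have hr0 : finrank F (perp η (LinearMap.ker B)) ≠ 0 := by
    intro h0
    refine hB (LinearMap.ker_eq_top.1 (Submodule.eq_top_of_finrank_eq (by omega)))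
  rw [Nat.even_iff] at heven
  have hrest : ¬ (n = 0 ∨ n = 2) → minDist q n =
      if Even n then (q : ℤ) ^ (4 * n + 4) else q ^ (4 * n + 4) - q ^ (3 * n + 3) :=
    fun hn => by rw [minDist, if_neg hn]
  obtain rfl | rfl | rfl | hn : n = 0 ∨ n = 1 ∨ n = 2 ∨ 3 ≤ n := by omega
  · refine le_trans (le_of_eq ?_) (h.weightSum_ge_of_even hV Even.zero
      (h.eigen_le_of_dim_four hV (by omega)))
    simp only [minDist]
    norm_num
    ring
  · rw [hrest (by omega)]
    by_cases hr : finrank F (perp η (LinearMap.ker B)) = 2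
    · exact h.weightSum_ge_of_rank_two hV le_rfl hr
    · simpa using h.weightSum_ge_of_dim_five hV (by omega)
  · by_cases hr : finrank F (perp η (LinearMap.ker B)) = 2
    · refine le_trans ?_ (h.weightSum_ge_of_rank_two hV (by omega) hr)
      rw [minDist, if_pos (Or.inr rfl), if_pos even_two]
      refine mul_le_mul_of_nonneg_right ?_ ?_
      · have : (0 : ℤ) ≤ q ^ (2 * 2 + 2) := by positivity
        linarith
      · have : (1 : ℤ) ≤ q ^ 4 := one_le_pow₀ (by linarith)
        linarith
    · refine le_trans (le_of_eq ?_) (h.weightSum_ge_of_even hV even_two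
        (h.eigen_le_of_dim_six hV (by omega)))
      simp only [minDist]
      norm_num
      ring
  · rw [hrest (by omega)]
    by_cases hr : finrank F (perp η (LinearMap.ker B)) = 2
    · exact h.weightSum_ge_of_rank_two hV (by omega) hr
    · exact h.weightSum_ge_of_rank_ge_four hV hn (by omega)

end Represents

/-- The alternating form `∑ η(aᵢ, ·) ∧ η(bᵢ, ·)`. -/
def wedgeSumForm {ι : Type*} [Fintype ι] (η : V →ₛₗ[σ] V →ₗ[F] F) (a b : ι → V) :
    V →ₗ[F] V →ₗ[F] F :=
  ∑ i, ((η (a i)).smulRight (η (b i)) - (η (b i)).smulRight (η (a i)))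

/-- The semilinear map representing `wedgeSumForm`. -/
def wedgeSumMap {ι : Type*} [Fintype ι] (η : V →ₛₗ[σ] V →ₗ[F] F) (a b : ι → V) (u : V) : V :=
  ∑ i, (σ (η (a i) u) • b i - σ (η (b i) u) • a i)

/-! ### Forms that attain the minimum weight. -/

namespace IsHermitianSpace

variable {q : ℕ} {η : V →ₛₗ[σ] V →ₗ[F] F} [Finite F] [Finite V]

theorem represents_wedgeSum (h : IsHermitianSpace q η) {ι : Type*} [Fintype ι] (a b : ι → V) :
    Represents q η (wedgeSumForm η a b) (wedgeSumMap η a b) := by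
  refine ⟨h, fun x => ?_, fun u v => ?_⟩
  · simp [wedgeSumForm, LinearMap.sum_apply, mul_comm]
  · simp [wedgeSumForm, wedgeSumMap, LinearMap.sum_apply, h.star_star]

theorem exists_isotropic_ne_zero (h : IsHermitianSpace q η) {n : ℕ} (hV : finrank F V = n + 4) :
    ∃ a : V, a ≠ 0 ∧ η a a = 0 := by
  have hq : (2 : ℤ) ≤ q := by exact_mod_cast h.two_le
  have h1 := h.ncard_isotropic_top hV
  have h2 : (1 : ℤ) < (isotropicVectors η ⊤).ncard := by
    rw [h1]
    have h3 : -((q - 1) * (q : ℤ) ^ (n + 3)) ≤ (-1) ^ n * (q - 1) * q ^ (n + 3) := by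
      have h7 : (0 : ℤ) ≤ (q - 1) * q ^ (n + 3) := mul_nonneg (by linarith) (by positivity)
      rcases neg_one_pow_eq_or ℤ n with h8 | h8 <;> rw [h8] <;> linarith
    have h4 : (q : ℤ) ^ (n + 4) ≤ q ^ (2 * n + 7) := pow_le_pow_right₀ (by linarith) (by omega)
    have h5 : (q : ℤ) ^ 1 ≤ q ^ (n + 3) := pow_le_pow_right₀ (by linarith) (by omega)
    have h6 : (q : ℤ) ^ (n + 4) = q ^ (n + 3) * q := pow_succ _ _
    linarith
  obtain ⟨a, ha, ha0⟩ := Set.exists_ne_of_one_lt_ncard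
    (s := isotropicVectors η ⊤) (by exact_mod_cast h2) 0
  exact ⟨a, ha0, ha.2⟩

theorem exists_isotropic_line (h : IsHermitianSpace q η) {n : ℕ} (hV : finrank F V = n + 4)
    (hn : Even n) {a : V} (ha : a ≠ 0) (haa : η a a = 0) :
    ∃ b : V, LinearIndependent F ![a, b] ∧ η a b = 0 ∧ η b b = 0 := by
  have hq : (2 : ℤ) ≤ q := by exact_mod_cast h.two_le
  have h1 := h.ncard_isotropicVectors_perp_singleton hV ha haa
  rw [hn.neg_one_pow] at h1
  have h2 : ¬ isotropicVectors η (perp η (F ∙ a)) ⊆ ((F ∙ a : Submodule F V) : Set V) := by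
    intro hsub
    have h3 := Set.ncard_le_ncard hsub
    rw [h.ncard_submodule, finrank_span_singleton ha] at h3
    zify at h3
    have h4 := mul_le_mul_of_nonneg_left h3 (show (0 : ℤ) ≤ q by linarith)
    rw [h1] at h4
    have h5 : (q : ℤ) ^ 6 ≤ q ^ (2 * n + 6) := pow_le_pow_right₀ (by linarith) (by omega)
    have h6 : (0 : ℤ) ≤ 1 * (q - 1) * q ^ (n + 4) := mul_nonneg (by linarith) (by positivity)
    have h7 : (q : ℤ) ^ 3 < q ^ 6 := pow_lt_pow_right₀ (by linarith) (by norm_num)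
    have h8 : (q : ℤ) * q ^ (2 * 1) = q ^ 3 := by ring
    linarith
  obtain ⟨b, hb, hb'⟩ := Set.not_subset.1 h2
  refine ⟨b, linearIndependent_pair_of_not_smul ha fun c hc => hb' ?_,
    hb.1 a (Submodule.mem_span_singleton_self a), hb.2⟩
  rw [hc]
  exact Submodule.smul_mem _ _ (Submodule.mem_span_singleton_self a)

theorem exists_tangent_line (h : IsHermitianSpace q η) {n : ℕ} (hV : finrank F V = n + 4)
    {a : V} (ha : a ≠ 0) : ∃ b : V, η a b = 0 ∧ η b b ≠ 0 := by
  by_contra! hc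
  have h1 : perp η (F ∙ a) ≤ perp η (perp η (F ∙ a)) := fun x hx y hy =>
    h.eq_zero_of_isotropic (W := perp η (F ∙ a))
      (fun w hw => hc w (hw a (Submodule.mem_span_singleton_self a))) hy hx
  rw [h.perp_perp] at h1
  have h2 := Submodule.finrank_mono h1
  have h3 := h.finrank_perp (F ∙ a)
  rw [finrank_span_singleton ha] at h2 h3
  omega

theorem wedgeSumForm_ne_zero (h : IsHermitianSpace q η) {a b : V}
    (hab : LinearIndependent F ![a, b]) :
    wedgeSumForm η (fun _ : Unit => a) (fun _ => b) ≠ 0 := by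
  intro h0
  rw [LinearIndependent.pair_iff] at hab
  have key : ∀ u v, η a u * η b v - η b u * η a v = 0 := by
    intro u v
    have := LinearMap.congr_fun (LinearMap.congr_fun h0 u) v
    simpa [wedgeSumForm] using this
  have hb0 : ∀ u, η b u = 0 := by
    intro u
    have h1 := (hab (σ (η b u)) (-σ (η a u)) (h.nondeg _ fun v => by
      simp only [map_add, map_smulₛₗ, map_neg, LinearMap.add_apply, LinearMap.smul_apply,
        smul_eq_mul, h.star_star]
      linear_combination - key u v)).1
    rwa [map_eq_zero] at h1
  have h2 := (hab 0 1 (by rw [h.nondeg b hb0]; simp)).2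
  exact one_ne_zero h2

theorem mem_eigenVectors_of_perp {a b : V} :
    isotropicVectors η (perp η (Submodule.span F {a, b})) ⊆
      eigenVectors η (wedgeSumMap η (fun _ : Unit => a) (fun _ => b)) := by
  rintro u ⟨hu, huu⟩
  refine ⟨huu, 0, ?_⟩
  rw [mem_perp_span] at hu
  simp [wedgeSumMap, hu a (by simp), hu b (by simp)]

/-- The form is `η(a,·) ∧ η(b,·)` on a totally isotropic line. The image of `f` lies in that line,
so nothing escapes, and all isotropic vectors orthogonal to the line are eigenvectors. -/
theorem exists_light_form_even (h : IsHermitianSpace q η) {n : ℕ} (hV : finrank F V = n + 4)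
    (hn : Even n) : ∃ (B : V →ₗ[F] V →ₗ[F] F) (f : V → V), Represents q η B f ∧ B ≠ 0 ∧
      weightSum η f q n ≤ q ^ (4 * n + 4) * (q ^ 4 - 1) := by
  have hq0 : (q : ℤ) ≠ 0 := by have := h.two_le; omega
  obtain ⟨a, ha, haa⟩ := h.exists_isotropic_ne_zero hV
  obtain ⟨b, hli, hab, hbb⟩ := h.exists_isotropic_line hV hn ha haa
  refine ⟨_, _, h.represents_wedgeSum (fun _ : Unit => a) (fun _ => b),
    h.wedgeSumForm_ne_zero hli, ?_⟩
  have h1 := Set.ncard_le_ncard (mem_eigenVectors_of_perp (η := η) (a := a) (b := b))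
  have h2 := h.ncard_isotropicVectors_perp_of_finrank_two hV (finrank_span_pair hli)
    (h.finrank_rad_pair_isotropic hli haa hab hbb)
  have h2' : ((isotropicVectors η (perp η (Submodule.span F {a, b}))).ncard : ℤ) =
      q ^ (2 * n + 3) + (-1) ^ n * (q - 1) * q ^ (n + 3) :=
    mul_left_cancel₀ hq0 (by rw [h2]; ring)
  have h3 : escapingVectors η (wedgeSumMap η (fun _ : Unit => a) (fun _ => b)) = ∅ := by
    ext u
    simp [escapingVectors, wedgeSumMap, haa, hab, hbb, h.isRefl hab]
  zify at h1
  rw [h2'] at h1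
  rw [weightSum, h3, Set.ncard_empty, h.ncard_isotropic_top hV]
  have h4 : (0 : ℤ) ≤ q ^ (2 * n + 1) := by positivity
  have h5 := mul_le_mul_of_nonneg_left h1 h4
  have h6 : (q : ℤ) ^ (4 * n + 4) * (q ^ 4 - 1) = q ^ (2 * n + 1) * (q ^ (2 * n + 7) +
    (-1) ^ n * (q - 1) * q ^ (n + 3)) - q ^ (2 * n + 1) *
    (q ^ (2 * n + 3) + (-1) ^ n * (q - 1) * q ^ (n + 3)) := by ring
  rw [h6]
  push_cast
  linarith

/-- With `a` isotropic and `b ⊥ a` anisotropic, `η (f u) (f u)` is the norm of `η a u` times `η b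
b`. Every isotropic `u` outside `a^⊥` escapes, which lowers the weight when `n` is odd. -/
theorem exists_light_form_odd (h : IsHermitianSpace q η) {n : ℕ} (hV : finrank F V = n + 4)
    (hn : Odd n) : ∃ (B : V →ₗ[F] V →ₗ[F] F) (f : V → V), Represents q η B f ∧ B ≠ 0 ∧
      weightSum η f q n ≤ (q ^ (4 * n + 4) - q ^ (3 * n + 3)) * (q ^ 4 - 1) := by
  have hq0 : (q : ℤ) ≠ 0 := by have := h.two_le; omega
  obtain ⟨a, ha, haa⟩ := h.exists_isotropic_ne_zero hV
  obtain ⟨b, hab, hbb⟩ := h.exists_tangent_line hV ha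
  have hli : LinearIndependent F ![a, b] := by
    refine linearIndependent_pair_of_not_smul ha fun c hc => hbb ?_
    rw [hc]
    simp [haa]
  refine ⟨_, _, h.represents_wedgeSum (fun _ : Unit => a) (fun _ => b),
    h.wedgeSumForm_ne_zero hli, ?_⟩
  have h1 := Set.ncard_le_ncard (mem_eigenVectors_of_perp (η := η) (a := a) (b := b))
  have h2 := h.ncard_isotropicVectors_perp_of_finrank_two hV (finrank_span_pair hli) (ρ := 1)
    (by rw [h.rad_pair_anisotropic haa hab hbb, finrank_span_singleton ha])
  have h2' : ((isotropicVectors η (perp η (Submodule.span F {a, b}))).ncard : ℤ) =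
      q ^ (2 * n + 3) - (-1) ^ n * (q - 1) * q ^ (n + 2) :=
    mul_left_cancel₀ hq0 (by rw [h2]; ring)
  have h3 : isotropicVectors η ⊤ \ isotropicVectors η (perp η (F ∙ a)) ⊆
      escapingVectors η (wedgeSumMap η (fun _ : Unit => a) (fun _ => b)) := by
    rintro u ⟨⟨-, huu⟩, hu⟩
    refine ⟨huu, fun h0 => hu ⟨mem_perp_span.2 ?_, huu⟩⟩
    rintro x rfl
    simpa [wedgeSumMap, haa, hab, hbb, h.isRefl hab, h.star_star] using h0
  have h4 := Set.ncard_le_ncard h3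
  have hsub : isotropicVectors η (perp η (F ∙ a)) ⊆ isotropicVectors η ⊤ :=
    fun u hu => ⟨trivial, hu.2⟩
  have h5 := Set.ncard_sdiff_add_ncard_of_subset hsub
  have h6 := h.ncard_isotropicVectors_perp_singleton hV ha haa
  have h6' : ((isotropicVectors η (perp η (F ∙ a))).ncard : ℤ) =
      q ^ (2 * n + 5) + (-1) ^ n * (q - 1) * q ^ (n + 3) :=
    mul_left_cancel₀ hq0 (by rw [h6]; ring)
  zify at h1 h4 h5
  rw [h2', hn.neg_one_pow] at h1
  rw [h6', h.ncard_isotropic_top hV, hn.neg_one_pow] at h5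
  rw [weightSum, h.ncard_isotropic_top hV, hn.neg_one_pow]
  have h7 : (0 : ℤ) ≤ q ^ (2 * n + 1) := by positivity
  have h8 : (0 : ℤ) ≤ q ^ n := by positivity
  have h9 := mul_le_mul_of_nonneg_left h1 h7
  have h10 : (q : ℤ) ^ (2 * n + 5) * (q ^ 2 - 1) ≤
      (escapingVectors η (wedgeSumMap η (fun _ : Unit => a) (fun _ => b))).ncard := by
    refine le_trans (le_of_eq ?_) h4
    linear_combination - h5
  have h11 := mul_le_mul_of_nonneg_left h10 h8
  have h12 : ((q : ℤ) ^ (4 * n + 4) - q ^ (3 * n + 3)) * (q ^ 4 - 1) = q ^ (2 * n + 1) *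
    (q ^ (2 * n + 7) + (-1) * (q - 1) * q ^ (n + 3)) - q ^ (2 * n + 1) *
    (q ^ (2 * n + 3) - (-1) * (q - 1) * q ^ (n + 2)) - q ^ n * (q ^ (2 * n + 5) * (q ^ 2 - 1)) := by
    ring
  rw [h12]
  linarith

section Orthonormal

/-- The complement of the span of the vectors found so far is not totally isotropic, since otherwise
it would lie in that span. An anisotropic vector in it is normalized by surjectivity of the norm
onto the nonzero fixed scalars. -/
theorem exists_orthonormal (h : IsHermitianSpace q η) (k : ℕ) (hk : k ≤ finrank F V) :
    ∃ v : Fin k → V, ∀ i j, η (v i) (v j) = if i = j then 1 else 0 := by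
  induction k with
  | zero => exact ⟨Fin.elim0, fun i => i.elim0⟩
  | succ k ih =>
    obtain ⟨v, hv⟩ := ih (by omega)
    set S := Submodule.span F (Set.range v) with hS
    have h1 := h.finrank_perp S
    have h2 : finrank F S ≤ k := by
      have := finrank_range_le_card (R := F) v
      rwa [Fintype.card_fin] at this
    obtain ⟨w, hw, hww⟩ : ∃ w ∈ perp η S, η w w ≠ 0 := by
      by_contra! hc
      have h3 : perp η S ≤ perp η (perp η S) := fun x hx y hy =>
        h.eq_zero_of_isotropic hc hy hx
      rw [h.perp_perp] at h3
      obtain ⟨⟨w, hw⟩, hw0⟩ := finrank_pos_iff_exists_ne_zero.1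
        (show 0 < finrank F (perp η S) by omega)
      apply hw0
      obtain ⟨c, hc⟩ := (Submodule.mem_span_range_iff_exists_fun F).1 (h3 hw)
      have h4 : ∀ j, c j = 0 := by
        intro j
        have h5 := hw (v j) (Submodule.subset_span ⟨j, rfl⟩)
        rw [← hc] at h5
        simpa [hv] using h5
      ext
      simp [← hc, h4]
    obtain ⟨a, ha⟩ : ∃ a, σ a * a = (η w w)⁻¹ := by
      have h3 := h.ncard_norm_fiber (t := (η w w)⁻¹) (inv_ne_zero hww)
        (by rw [map_inv₀, h.star_self])
      have h4 : {a : F | σ a * a = (η w w)⁻¹}.Nonempty := by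
        rw [← Set.ncard_pos]
        omega
      exact h4
    have h5 : ∀ i, η (v i) w = 0 := fun i => hw _ (Submodule.subset_span ⟨i, rfl⟩)
    refine ⟨Fin.cons (a • w) v, fun i j => ?_⟩
    refine Fin.cases ?_ (fun i => ?_) i <;> refine Fin.cases ?_ (fun j => ?_) j
    · simp only [Fin.cons_zero, map_smulₛₗ, LinearMap.smul_apply, smul_eq_mul, RingHom.id_apply,
        if_true]
      rw [← mul_assoc, mul_comm a, ha, inv_mul_cancel₀ hww]
    · simp [h.isRefl (h5 j), (Fin.succ_ne_zero j).symm]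
    · simp [h5 i]
    · simp [hv]

theorem orthonormal_expansion (h : IsHermitianSpace q η) {ι : Type*} [Fintype ι] [DecidableEq ι]
    {v : ι → V} (hv : ∀ i j, η (v i) (v j) = if i = j then 1 else 0)
    (hcard : Fintype.card ι = finrank F V) (u : V) : u = ∑ i, η (v i) u • v i := by
  have hli : LinearIndependent F v := by
    rw [Fintype.linearIndependent_iff]
    intro g hg i
    have := congrArg (η (v i)) hg
    simpa [hv] using this
  have h1 := h.finrank_perp (Submodule.span F (Set.range v))
  rw [finrank_span_eq_card hli] at h1
  have h2 : perp η (Submodule.span F (Set.range v)) = ⊥ :=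
    Submodule.finrank_eq_zero.1 (by omega)
  rw [← sub_eq_zero, ← Submodule.mem_bot F, ← h2, mem_perp_span]
  rintro _ ⟨j, rfl⟩
  simp [hv]

/-- In an orthonormal basis `x_i, y_i`, the form `∑ η(x_i,·) ∧ η(y_i,·)` is represented by the
semilinear map `x_i ↦ y_i`, `y_i ↦ -x_i`. -/
theorem exists_symplectic_structure (h : IsHermitianSpace q η) {k : ℕ}
    (hV : finrank F V = k + k) : ∃ (B : V →ₗ[F] V →ₗ[F] F) (f : V → V), Represents q η B f ∧
      ∀ u, f (f u) = - u := by
  obtain ⟨v, hv⟩ := h.exists_orthonormal (k + k) hV.ge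
  set w : Fin k ⊕ Fin k → V := v ∘ finSumFinEquiv with hw
  have hw' : ∀ i j, η (w i) (w j) = if i = j then 1 else 0 := by
    intro i j
    simp [hw, hv]
  refine ⟨_, _, h.represents_wedgeSum (fun i => w (.inl i)) (fun i => w (.inr i)), fun u => ?_⟩
  have h1 := h.orthonormal_expansion hw' (by simp [hV]) u
  have hx : ∀ j, η (w (.inl j)) (wedgeSumMap η (fun i => w (.inl i)) (fun i => w (.inr i)) u) =
      - σ (η (w (.inr j)) u) := by
    intro j
    simp [wedgeSumMap, hw']
  have hy : ∀ j, η (w (.inr j)) (wedgeSumMap η (fun i => w (.inl i)) (fun i => w (.inr i)) u) =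
      σ (η (w (.inl j)) u) := by
    intro j
    simp [wedgeSumMap, hw']
  conv_rhs => rw [h1]
  rw [wedgeSumMap]
  simp only [hx, hy, map_neg, h.star_star]
  rw [Fintype.sum_sum_type, ← Finset.sum_add_distrib, ← Finset.sum_neg_distrib]
  refine Finset.sum_congr rfl fun i _ => ?_
  rw [neg_smul]
  abel

end Orthonormal

end IsHermitianSpace

/-! ### Eigenvectors when `f² = -1`. -/

namespace Represents

variable {q : ℕ} {η : V →ₛₗ[σ] V →ₗ[F] F} {B : V →ₗ[F] V →ₗ[F] F} {f : V → V}
variable [Finite F] [Finite V]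

/-- The additive map `f + σ c` has image in the solutions for `c` and kernel in the solutions for
`-σ c`. Both sets have at most `q^d` elements, `d = dim V`, while `V` has `q^(2d)`, so equality
holds. -/
theorem ncard_fixed_of_square (h : Represents q η B f) (hsq : ∀ u, f (f u) = - u) {c : F}
    (hc : σ c * c = -1) : {u | f u = c • u}.ncard = q ^ finrank F V := by
  have hle : ∀ c : F, c ≠ 0 → {u | f u = c • u}.ncard ≤ q ^ finrank F V := by
    intro c hc
    have := h.ncard_fixed_le (W := ⊤) hc fun u _ => trivial
    rwa [finrank_top] at this
  have hc0 : c ≠ 0 := by rintro rfl; simp at hc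
  refine le_antisymm (hle c hc0) ?_
  let g : V →+ V :=
    { toFun := fun u => f u + σ c • u
      map_zero' := by simp [h.map_zero]
      map_add' := fun u v => by rw [h.map_add, smul_add]; abel }
  have h1 := AddSubgroup.card_eq_card_quotient_mul_card_addSubgroup g.ker
  rw [Nat.card_congr (QuotientAddGroup.quotientKerEquivRange g).toEquiv, h.natCard_space] at h1
  have h2 : Nat.card g.range ≤ {u | f u = c • u}.ncard := by
    rw [← Nat.card_coe_set_eq]
    refine Set.ncard_le_ncard (s := (g.range : Set V)) ?_
    rintro _ ⟨u, rfl⟩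
    change f (f u + σ c • u) = c • (f u + σ c • u)
    rw [h.map_add, hsq, h.map_smul, h.star_star, smul_add, smul_smul, mul_comm, hc, neg_one_smul]
    abel
  have h3 : Nat.card g.ker ≤ q ^ finrank F V := by
    refine le_trans ?_ (hle (- σ c) (neg_ne_zero.2 ((map_ne_zero σ).2 hc0)))
    refine Set.ncard_le_ncard (s := (g.ker : Set V)) ?_
    intro u hu
    have : f u + σ c • u = 0 := hu
    rw [Set.mem_ofPred_eq, neg_smul, ← add_eq_zero_iff_eq_neg, this]
  have h4 : q ^ finrank F V * q ^ finrank F V ≤ {u | f u = c • u}.ncard * q ^ finrank F V := by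
    rw [← pow_add, ← two_mul, h1]
    exact Nat.mul_le_mul h2 h3
  exact Nat.le_of_mul_le_mul_right h4 (Nat.pow_pos (by have := h.two_le; omega))

/-- Each of the `q + 1` scalars of norm `-1` contributes; these eigenvectors are isotropic because
`0 = η (f u) u = σ c * η u u`. -/
theorem ncard_eigenVectors_ge_of_square (h : Represents q η B f) (hsq : ∀ u, f (f u) = - u) :
    1 + (q + 1) * (q ^ finrank F V - 1) ≤ (eigenVectors η f).ncard := by
  have h1 := ncard_pairs_of_constant
    (fun (c : F) (u : V) => σ c * c = -1 ∧ u ≠ 0 ∧ f u = c • u) {c | σ c * c = -1}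
    (q ^ finrank F V - 1)
    (fun c hc => by
      have h2 : {u : V | σ c * c = -1 ∧ u ≠ 0 ∧ f u = c • u} = {u | f u = c • u} \ {0} := by
        ext u
        rw [Set.mem_ofPred_eq] at hc
        simp [hc, and_comm]
      have h3 : (0 : V) ∈ {u | f u = c • u} := by simp [h.map_zero]
      rw [h2, Set.ncard_sdiff_singleton_of_mem h3, h.ncard_fixed_of_square hsq hc])
    (fun c hc u hu => hc hu.1)
  rw [h.ncard_norm_fiber (neg_ne_zero.2 one_ne_zero) (by simp)] at h1
  have hinj : Set.InjOn Prod.snd {p : F × V | σ p.1 * p.1 = -1 ∧ p.2 ≠ 0 ∧ f p.2 = p.1 • p.2} := by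
    rintro ⟨c, u⟩ ⟨-, hu0, hu⟩ ⟨d, v⟩ ⟨-, -, hv⟩ huv
    simp only at huv hu hv hu0
    subst huv
    rw [hu] at hv
    rw [smul_left_injective F hu0 hv]
  rw [← h1, ← hinj.ncard_image, ← Set.ncard_singleton (0 : V), ← Set.ncard_union_eq]
  · refine Set.ncard_le_ncard ?_
    rintro u (hu | ⟨⟨c, v⟩, ⟨hc, hv0, hv⟩, rfl⟩)
    · rw [Set.mem_singleton_iff.1 hu]
      exact h.zero_mem_eigenVectors
    · refine ⟨?_, c, hv⟩
      have h2 := h.map_self v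
      simp only at hv hc
      have hc0 : c ≠ 0 := by rintro rfl; simp at hc
      rw [hv, map_smulₛₗ, LinearMap.smul_apply, smul_eq_mul, mul_eq_zero] at h2
      exact h2.resolve_left ((map_ne_zero σ).2 hc0)
  · rw [Set.disjoint_left]
    rintro u hu ⟨⟨c, v⟩, ⟨-, hv0, -⟩, rfl⟩
    exact hv0 (Set.mem_singleton_iff.1 hu)

end Represents

namespace IsHermitianSpace

variable {q : ℕ} {η : V →ₛₗ[σ] V →ₗ[F] F} [Finite F] [Finite V]

theorem exists_light_form_symplectic (h : IsHermitianSpace q η) {n : ℕ} (hV : finrank F V = n + 4)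
    (hn : n = 0 ∨ n = 2) : ∃ (B : V →ₗ[F] V →ₗ[F] F) (f : V → V), Represents q η B f ∧ B ≠ 0 ∧
      weightSum η f q n ≤ (q ^ (4 * n + 4) - q ^ (2 * n + 2)) * (q ^ 4 - 1) := by
  have he : Even n := by rcases hn with rfl | rfl <;> decide
  obtain ⟨k, hk⟩ : Even (n + 4) := by rcases hn with rfl | rfl <;> decide
  obtain ⟨B, f, hf, hsq⟩ := h.exists_symplectic_structure (hV.trans hk)
  refine ⟨B, f, hf, ?_, ?_⟩
  · rintro rfl
    have : Nontrivial V := by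
      rw [← finrank_pos_iff (R := F)]
      omega
    obtain ⟨u, hu⟩ := exists_ne (0 : V)
    have h1 := hsq u
    rw [hf.map_eq_zero_iff.2 (show u ∈ LinearMap.ker (0 : V →ₗ[F] V →ₗ[F] F) by simp),
      hf.map_zero] at h1
    exact hu (neg_eq_zero.1 h1.symm)
  · have hesc : escapingVectors η f = ∅ := by
      ext u
      simp only [escapingVectors, Set.mem_ofPred_eq, Set.mem_empty_iff_false, iff_false, not_and,
        not_not]
      intro hu
      rw [hf.form_map_map, hsq]
      simp [hu]
    have h1 := hf.ncard_eigenVectors_ge_of_square hsq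
    have h2 : 1 ≤ q ^ finrank F V := Nat.one_le_pow _ _ (by have := h.two_le; omega)
    zify [h2] at h1
    rw [hV] at h1
    rw [weightSum, hesc, Set.ncard_empty, h.ncard_isotropic_top hV, he.neg_one_pow]
    have h4 : (0 : ℤ) ≤ q ^ (2 * n + 1) := by positivity
    have h5 := mul_le_mul_of_nonneg_left h1 h4
    -- This reduces to `q^(4n+4) + q^(2n+6) = q^(3n+6) + q^(3n+4)`, which holds only for `n = 0` and
    -- `n = 2`: hence the exceptional dimensions four and six.
    have h6 : ((q : ℤ) ^ (4 * n + 4) - q ^ (2 * n + 2)) * (q ^ 4 - 1) = q ^ (2 * n + 1) *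
      (q ^ (2 * n + 7) + 1 * (q - 1) * q ^ (n + 3)) -
      q ^ (2 * n + 1) * (1 + (q + 1) * (q ^ (n + 4) - 1)) := by
      rcases hn with rfl | rfl <;> ring
    rw [h6]
    push_cast
    linarith

theorem exists_light_form (h : IsHermitianSpace q η) {n : ℕ} (hV : finrank F V = n + 4) :
    ∃ (B : V →ₗ[F] V →ₗ[F] F) (f : V → V), Represents q η B f ∧ B ≠ 0 ∧
      weightSum η f q n ≤ minDist q n * (q ^ 4 - 1) := by
  rw [minDist]
  split_ifs with h1 h2
  · exact h.exists_light_form_symplectic hV h1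
  · exact h.exists_light_form_even hV h2
  · exact h.exists_light_form_odd hV (Nat.not_even_iff_odd.1 h2)

end IsHermitianSpace

/-! ### Functionals on the exterior square as alternating forms. -/

section AlternatingForms

/-- An alternating bilinear form, as an alternating map. -/
def toAlternatingMap (B : V →ₗ[F] V →ₗ[F] F) (hB : ∀ x, B x x = 0) : V [⋀^Fin 2]→ₗ[F] F where
  toFun m := B (m 0) (m 1)
  map_update_add' m i x y := by fin_cases i <;> simp
  map_update_smul' m i c x := by fin_cases i <;> simp
  map_eq_zero_of_eq' m i j hij hne := by
    have h01 : m 0 = m 1 := by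
      fin_cases i <;> fin_cases j <;> simp_all
    rw [h01, hB]

theorem update_pair_zero {α : Type*} (u v x : α) : Function.update ![u, v] 0 x = ![x, v] := by
  ext i; fin_cases i <;> simp

theorem update_pair_one {α : Type*} (u v x : α) : Function.update ![u, v] 1 x = ![u, x] := by
  ext i; fin_cases i <;> simp

/-- The alternating bilinear form of a linear functional on the second exterior power. -/
noncomputable def formOf (φ : Dual F (⋀[F]^2 V)) : V →ₗ[F] V →ₗ[F] F :=
  LinearMap.mk₂ F (fun u v => φ (exteriorPower.ιMulti F 2 ![u, v]))
    (fun u u' v => by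
      have := (exteriorPower.ιMulti F 2 (M := V)).map_update_add ![u, v] 0 u u'
      rw [update_pair_zero, update_pair_zero, update_pair_zero] at this
      rw [← map_add, ← this])
    (fun c u v => by
      have := (exteriorPower.ιMulti F 2 (M := V)).map_update_smul ![u, v] 0 c u
      rw [update_pair_zero, update_pair_zero] at this
      rw [← map_smul, ← this])
    (fun u v v' => by
      have := (exteriorPower.ιMulti F 2 (M := V)).map_update_add ![u, v] 1 v v'
      rw [update_pair_one, update_pair_one, update_pair_one] at this
      rw [← map_add, ← this])
    (fun c u v => by
      have := (exteriorPower.ιMulti F 2 (M := V)).map_update_smul ![u, v] 1 c v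
      rw [update_pair_one, update_pair_one] at this
      rw [← map_smul, ← this])

theorem formOf_apply (φ : Dual F (⋀[F]^2 V)) (u v : V) :
    formOf φ u v = φ (exteriorPower.ιMulti F 2 ![u, v]) := rfl

theorem formOf_self (φ : Dual F (⋀[F]^2 V)) (u : V) : formOf φ u u = 0 := by
  rw [formOf_apply, (exteriorPower.ιMulti F 2).map_eq_zero_of_eq ![u, u] (i := 0) (j := 1) rfl
    (by decide), map_zero]

theorem formOf_ne_zero {φ : Dual F (⋀[F]^2 V)} (hφ : φ ≠ 0) : formOf φ ≠ 0 := by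
  intro h0
  apply hφ
  refine exteriorPower.linearMap_ext ?_
  ext m
  have h1 := LinearMap.congr_fun (LinearMap.congr_fun h0 (m 0)) (m 1)
  rw [formOf_apply] at h1
  have h2 : ![m 0, m 1] = m := by ext i; fin_cases i <;> rfl
  rw [h2] at h1
  simpa using h1

theorem exists_formOf_eq {B : V →ₗ[F] V →ₗ[F] F} (hB : ∀ x, B x x = 0) :
    ∃ φ : Dual F (⋀[F]^2 V), formOf φ = B := by
  refine ⟨exteriorPower.alternatingMapLinearEquiv (toAlternatingMap B hB), ?_⟩
  ext u v
  rw [formOf_apply, exteriorPower.alternatingMapLinearEquiv_apply_ιMulti]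
  rfl

end AlternatingForms

/-! ### Injectivity of the Plücker embedding on lines. -/

section Pluecker

variable [FiniteDimensional F V]

theorem pluecker_submodule_pair (X : {X : Submodule F V // finrank F X = 2}) {u v : V}
    (hu : u ∈ X.1) (hv : v ∈ X.1) (huv : LinearIndependent F ![u, v]) :
    (pluecker 2 X).submodule = Submodule.span F {exteriorPower.ιMulti F 2 ![u, v]} := by
  have hli : LinearIndependent F ![(⟨u, hu⟩ : X.1), ⟨v, hv⟩] := by
    refine LinearIndependent.of_comp X.1.subtype ?_
    convert huv using 1
    ext i
    fin_cases i <;> rfl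
  have hb : ∀ i, (basisOfLinearIndependentOfCardEqFinrank hli (by simp [X.2]) i : V) =
      ![u, v] i := by
    intro i
    rw [coe_basisOfLinearIndependentOfCardEqFinrank]
    fin_cases i <;> rfl
  rw [pluecker_submodule 2 X (basisOfLinearIndependentOfCardEqFinrank hli (by simp [X.2]))]
  simp_rw [hb]

theorem exists_pair_of_mem {X : Submodule F V} (hX : finrank F X = 2) {u : V} (hu0 : u ≠ 0) :
    ∃ v ∈ X, LinearIndependent F ![u, v] := by
  have h1 : ¬ X ≤ F ∙ u := by
    intro hle
    have := Submodule.finrank_mono hle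
    rw [hX, finrank_span_singleton hu0] at this
    omega
  obtain ⟨v, hv, hv'⟩ := Set.not_subset.1 h1
  refine ⟨v, hv, linearIndependent_pair_of_not_smul hu0 fun c hc => hv' ?_⟩
  rw [hc]
  exact Submodule.smul_mem _ _ (Submodule.mem_span_singleton_self u)

/-- For `u' ∈ Y` outside `X`, take `α` vanishing on `X` but not at `u'`, and `β` vanishing at `u'`
but not at a second basis vector `v'` of `Y`. Then `α ∧ β` kills `⋀²X` but not `u' ∧ v'`. -/
theorem le_of_pluecker_eq {X Y : {X : Submodule F V // finrank F X = 2}}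
    (h : pluecker 2 X = pluecker 2 Y) : Y.1 ≤ X.1 := by
  intro u' hu'
  by_contra hu'X
  have hu0 : u' ≠ 0 := by rintro rfl; exact hu'X X.1.zero_mem
  obtain ⟨v', hv', hli'⟩ := exists_pair_of_mem Y.2 hu0
  obtain ⟨⟨u, hu⟩, hu0'⟩ := finrank_pos_iff_exists_ne_zero.1
    (show 0 < finrank F X.1 by rw [X.2]; simp)
  obtain ⟨v, hv, hli⟩ := exists_pair_of_mem X.2 (show u ≠ 0 from fun h0 => hu0' (Subtype.ext h0))
  obtain ⟨α, hα, hαX⟩ := Submodule.exists_le_ker_of_notMem hu'X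
  have hv'u : v' ∉ (F ∙ u' : Submodule F V) := by
    intro hmem
    obtain ⟨c, hc⟩ := Submodule.mem_span_singleton.1 hmem
    exact (LinearIndependent.pair_iff' hu0).1 hli' c hc
  obtain ⟨β, hβ, hβu⟩ := Submodule.exists_le_ker_of_notMem hv'u
  have hαu : α u = 0 := hαX hu
  have hαv : α v = 0 := hαX hv
  have hβu' : β u' = 0 := hβu (Submodule.mem_span_singleton_self u')
  obtain ⟨φ, hφ⟩ := exists_formOf_eq (B := α.smulRight β - β.smulRight α)
    (fun x => by simp [mul_comm])
  have h1 : exteriorPower.ιMulti F 2 ![u', v'] ∈ (pluecker 2 X).submodule := by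
    rw [h, pluecker_submodule_pair Y hu' hv' hli']
    exact Submodule.mem_span_singleton_self _
  rw [pluecker_submodule_pair X hu hv hli, Submodule.mem_span_singleton] at h1
  obtain ⟨c, hc⟩ := h1
  have h2 := congrArg φ hc
  rw [map_smul, ← formOf_apply, ← formOf_apply, hφ] at h2
  simp [hαu, hαv, hβu', hα, hβ] at h2

theorem pluecker_injective :
    Function.Injective (pluecker 2 : {X : Submodule F V // finrank F X = 2} → _) :=
  fun _ _ h => Subtype.ext (le_antisymm (le_of_pluecker_eq h.symm) (le_of_pluecker_eq h))

theorem IsRepresentativeSystem.exists_equiv {η : V →ₛₗ[σ] V →ₗ[F] F} {N : ℕ}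
    {ω : Fin N → ⋀[F]^2 V} (hω : IsRepresentativeSystem (hermitianLineVariety η) ω) :
    ∃ e : Fin N ≃ isotropicLines η, ∀ i, (pluecker 2 (e i).1).submodule = F ∙ ω i := by
  have h1 : ∀ i, ∃ X : isotropicLines η,
      pluecker 2 X.1 = Projectivization.mk F (ω i) (hω.ne_zero i) := by
    intro i
    obtain ⟨X, hX, hXi⟩ := hω.bijOn.mapsTo (Set.mem_univ i)
    exact ⟨⟨X, hX⟩, hXi⟩
  choose g hg using h1
  refine ⟨Equiv.ofBijective g ⟨fun i j hij => ?_, fun X => ?_⟩, fun i => ?_⟩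
  · refine hω.bijOn.injOn (Set.mem_univ i) (Set.mem_univ j) ?_
    rw [← hg, ← hg, hij]
  · obtain ⟨i, -, hi⟩ := hω.bijOn.surjOn ⟨X.1, X.2, rfl⟩
    refine ⟨i, Subtype.ext (pluecker_injective ?_)⟩
    rw [hg, ← hi]
  · change (pluecker 2 (g i).1).submodule = _
    rw [hg, Projectivization.submodule_mk]

end Pluecker

/-! ### Ordered bases of totally isotropic lines. -/

section Pairs

variable {q : ℕ} {η : V →ₛₗ[σ] V →ₗ[F] F} [Finite F] [Finite V]

theorem span_pair_eq_of_mem {X : Submodule F V} (hX : finrank F X = 2) {u v : V} (hu : u ∈ X)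
    (hv : v ∈ X) (huv : LinearIndependent F ![u, v]) : Submodule.span F {u, v} = X := by
  refine Submodule.eq_of_le_of_finrank_eq ?_ (by rw [finrank_span_pair huv, hX])
  rw [Submodule.span_le]
  rintro x (rfl | rfl) <;> assumption

theorem linearIndependent_pair_iff_notMem {u v : V} (hu : u ≠ 0) :
    LinearIndependent F ![u, v] ↔ v ∉ (F ∙ u : Submodule F V) := by
  rw [LinearIndependent.pair_iff' hu, Submodule.mem_span_singleton]
  push Not
  rfl

theorem IsHermitianSpace.ncard_bases (h : IsHermitianSpace q η) {X : Submodule F V}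
    (hX : finrank F X = 2) :
    {p : V × V | p.1 ∈ X ∧ p.2 ∈ X ∧ LinearIndependent F ![p.1, p.2]}.ncard =
      (q ^ 4 - 1) * (q ^ 4 - q ^ 2) := by
  have hXc := h.ncard_submodule X
  rw [hX] at hXc
  have h1 := ncard_pairs_of_constant
    (fun u v : V => u ∈ X ∧ v ∈ X ∧ LinearIndependent F ![u, v]) ((X : Set V) \ {0})
    (q ^ 4 - q ^ 2)
    (fun u hu => by
      have hu0 : u ≠ 0 := hu.2
      have h2 : {v | u ∈ X ∧ v ∈ X ∧ LinearIndependent F ![u, v]} =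
          (X : Set V) \ ((F ∙ u : Submodule F V) : Set V) := by
        ext v
        have : u ∈ X := hu.1
        simp [this, linearIndependent_pair_iff_notMem hu0]
      have h3 : ((F ∙ u : Submodule F V) : Set V) ⊆ X := by
        rw [SetLike.coe_subset_coe, Submodule.span_singleton_le_iff_mem]
        exact hu.1
      rw [h2, Set.ncard_sdiff h3, hXc, h.ncard_submodule, finrank_span_singleton hu0])
    (fun u hu v hv => hu ⟨hv.1, fun h0 => by
      have := hv.2.2.ne_zero 0
      simp at this
      exact this h0⟩)
  rw [h1, Set.ncard_sdiff_singleton_of_mem X.zero_mem, hXc]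

theorem IsHermitianSpace.exists_line_of_pair (h : IsHermitianSpace q η) {ι : Type*}
    (e : ι ≃ isotropicLines η) {u v : V} (huu : η u u = 0) (hvv : η v v = 0) (huv : η u v = 0)
    (hli : LinearIndependent F ![u, v]) : ∃ i, u ∈ (e i).1.1 ∧ v ∈ (e i).1.1 := by
  have hline : ∀ x ∈ Submodule.span F {u, v}, ∀ y ∈ Submodule.span F {u, v}, η x y = 0 := by
    intro x hx y hy
    obtain ⟨a, b, rfl⟩ := Submodule.mem_span_pair.1 hx
    obtain ⟨c, d, rfl⟩ := Submodule.mem_span_pair.1 hy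
    simp [huu, hvv, huv, h.isRefl huv]
  have hX : (⟨Submodule.span F {u, v}, finrank_span_pair hli⟩ :
    {X : Submodule F V // finrank F X = 2}) ∈ isotropicLines η := hline
  obtain ⟨i, hi⟩ := e.surjective ⟨_, hX⟩
  refine ⟨i, ?_, ?_⟩ <;> rw [hi] <;> exact Submodule.subset_span (by simp)

/-- Double counting of the ordered bases of a family of totally isotropic lines. -/
theorem IsHermitianSpace.ncard_pairs_of_lines (h : IsHermitianSpace q η) {N : ℕ}
    (e : Fin N ≃ isotropicLines η) (Q : Set (Fin N)) (P : Set (V × V))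
    (hP : ∀ p, p ∈ P ↔ (η p.1 p.1 = 0 ∧ η p.2 p.2 = 0 ∧ η p.1 p.2 = 0 ∧
      LinearIndependent F ![p.1, p.2]) ∧ ∀ i, p.1 ∈ (e i).1.1 → p.2 ∈ (e i).1.1 → i ∈ Q) :
    P.ncard = Q.ncard * ((q ^ 4 - 1) * (q ^ 4 - q ^ 2)) := by
  have h1 := ncard_pairs_of_constant
    (fun (i : Fin N) (p : V × V) => i ∈ Q ∧ p.1 ∈ (e i).1.1 ∧ p.2 ∈ (e i).1.1 ∧
      LinearIndependent F ![p.1, p.2]) Q ((q ^ 4 - 1) * (q ^ 4 - q ^ 2))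
    (fun i hi => by
      simp only [hi, true_and]
      exact h.ncard_bases (e i).1.2)
    (fun i hi p hp => hi hp.1)
  -- An independent isotropic pair lies on exactly one listed line, so the universal quantifier in
  -- `hP` says that this line belongs to `Q`.
  have huniq : ∀ i j (p : V × V), p.1 ∈ (e i).1.1 → p.2 ∈ (e i).1.1 → p.1 ∈ (e j).1.1 →
      p.2 ∈ (e j).1.1 → LinearIndependent F ![p.1, p.2] → i = j := by
    intro i j p h1 h2 h3 h4 h5
    refine e.injective (Subtype.ext (Subtype.ext ?_))
    rw [← span_pair_eq_of_mem (e i).1.2 h1 h2 h5, ← span_pair_eq_of_mem (e j).1.2 h3 h4 h5]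
  rw [← h1]
  symm
  refine Set.BijOn.ncard_eq (f := Prod.snd) ⟨?_, ?_, ?_⟩
  · rintro ⟨i, p⟩ ⟨hi, h2, h3, h4⟩
    simp only at hi h2 h3 h4
    refine (hP p).2 ⟨⟨(e i).2 _ h2 _ h2, (e i).2 _ h3 _ h3, (e i).2 _ h2 _ h3, h4⟩,
      fun j hj1 hj2 => ?_⟩
    rw [← huniq i j p h2 h3 hj1 hj2 h4]
    exact hi
  · rintro ⟨i, p⟩ ⟨hi, h2, h3, h4⟩ ⟨j, p'⟩ ⟨hj, h2', h3', h4'⟩ heq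
    simp only at h2 h3 h4 h2' h3' h4' heq
    subst heq
    rw [huniq i j p h2 h3 h2' h3' h4]
  · intro p hp
    obtain ⟨⟨h2, h3, h4, h5⟩, h6⟩ := (hP p).1 hp
    obtain ⟨i, h7, h8⟩ := h.exists_line_of_pair e h2 h3 h4 h5
    exact ⟨(i, p), ⟨h6 i h7 h8, h7, h8, h5⟩, rfl⟩

theorem linearIndependent_of_form_ne_zero {B : V →ₗ[F] V →ₗ[F] F} (hB : ∀ x, B x x = 0) {u v : V}
    (huv : B u v ≠ 0) : LinearIndependent F ![u, v] := by
  refine linearIndependent_pair_of_not_smul ?_ ?_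
  · rintro rfl
    simp at huv
  · rintro c rfl
    simp [hB] at huv

theorem IsHermitianSpace.ncard_isotropic_pairs (h : IsHermitianSpace q η) {n : ℕ}
    (hV : finrank F V = n + 4) :
    ({p : V × V | η p.1 p.1 = 0 ∧ η p.2 p.2 = 0 ∧ η p.1 p.2 = 0 ∧
      LinearIndependent F ![p.1, p.2]}.ncard : ℤ) =
      (q ^ (2 * n + 7) + (-1) ^ n * (q - 1) * q ^ (n + 3) - 1) *
      (q ^ (2 * n + 5) + (-1) ^ n * (q - 1) * q ^ (n + 3) - q ^ 2) := by
  have hq0 : (q : ℤ) ≠ 0 := by have := h.two_le; omega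
  have key : ∀ u ∈ isotropicVectors η ⊤ \ {0},
      ({v | η u u = 0 ∧ η v v = 0 ∧ η u v = 0 ∧ LinearIndependent F ![u, v]}.ncard : ℤ) =
        q ^ (2 * n + 5) + (-1) ^ n * (q - 1) * q ^ (n + 3) - q ^ 2 := by
    rintro u ⟨⟨-, huu⟩, hu0⟩
    have hu0' : u ≠ 0 := hu0
    have h2 : {v | η u u = 0 ∧ η v v = 0 ∧ η u v = 0 ∧ LinearIndependent F ![u, v]} =
        isotropicVectors η (perp η (F ∙ u)) \ ((F ∙ u : Submodule F V) : Set V) := by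
      ext v
      simp only [huu, true_and, Set.mem_ofPred_eq, linearIndependent_pair_iff_notMem hu0',
        Set.mem_sdiff, isotropicVectors, mem_perp_span, Set.mem_singleton_iff, forall_eq,
        SetLike.mem_coe]
      tauto
    have h3 : ((F ∙ u : Submodule F V) : Set V) ⊆ isotropicVectors η (perp η (F ∙ u)) := by
      intro v hv
      obtain ⟨c, rfl⟩ := Submodule.mem_span_singleton.1 hv
      refine ⟨mem_perp_span.2 ?_, by simp [huu]⟩
      rintro x rfl
      simp [huu]
    have h4 := Set.ncard_sdiff_add_ncard_of_subset h3
    rw [h.ncard_submodule, finrank_span_singleton hu0', ← h2] at h4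
    have h5 := h.ncard_isotropicVectors_perp_singleton hV hu0' huu
    have h5' : ((isotropicVectors η (perp η (F ∙ u))).ncard : ℤ) =
        q ^ (2 * n + 5) + (-1) ^ n * (q - 1) * q ^ (n + 3) :=
      mul_left_cancel₀ hq0 (by rw [h5]; ring)
    zify at h4
    rw [h5'] at h4
    linear_combination h4
  -- One isotropic vector serves to name the common fibre size as a natural number.
  obtain ⟨a, ha, haa⟩ := h.exists_isotropic_ne_zero hV
  have hmem : a ∈ isotropicVectors η ⊤ \ {0} := ⟨⟨trivial, haa⟩, ha⟩
  have h1 := ncard_pairs_of_constant (fun u v : V => η u u = 0 ∧ η v v = 0 ∧ η u v = 0 ∧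
      LinearIndependent F ![u, v]) (isotropicVectors η ⊤ \ {0}) _
    (fun u hu => by
      have := (key u hu).trans (key a hmem).symm
      exact_mod_cast this)
    (fun u hu v hv => hu ⟨⟨trivial, hv.1⟩, fun h0 => by
      have := hv.2.2.2.ne_zero 0
      simp at this
      exact this h0⟩)
  have h0 : (0 : V) ∈ isotropicVectors η ⊤ := ⟨trivial, by simp⟩
  rw [h1]
  push_cast
  rw [key a hmem, ← h.ncard_isotropic_top hV]
  have h2 := Set.ncard_sdiff_singleton_add_one h0
  zify at h2
  rw [← h2]
  ring

end Pairs

/-! ### Weights of words and the parameters of the code. -/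

section Weights

variable {q : ℕ} {η : V →ₛₗ[σ] V →ₗ[F] F} [Finite F] [Finite V]

theorem eval_ne_zero_iff {X : {X : Submodule F V // finrank F X = 2}} {w : ⋀[F]^2 V}
    (hX : (pluecker 2 X).submodule = F ∙ w) (φ : Dual F (⋀[F]^2 V)) {u v : V}
    (hu : u ∈ X.1) (hv : v ∈ X.1) (huv : LinearIndependent F ![u, v]) :
    φ w ≠ 0 ↔ formOf φ u v ≠ 0 := by
  rw [pluecker_submodule_pair X hu hv huv] at hX
  obtain ⟨a, ha⟩ := Submodule.mem_span_singleton.1 (hX ▸ Submodule.mem_span_singleton_self w)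
  obtain ⟨b, hb⟩ := Submodule.mem_span_singleton.1
    (hX ▸ Submodule.mem_span_singleton_self (exteriorPower.ιMulti F 2 ![u, v]))
  rw [formOf_apply, not_iff_not]
  constructor <;> intro h0
  · rw [← hb, map_smul, h0, smul_zero]
  · rw [← ha, map_smul, h0, smul_zero]

theorem IsHermitianSpace.cast_bases (h : IsHermitianSpace q η) :
    (((q ^ 4 - 1) * (q ^ 4 - q ^ 2) : ℕ) : ℤ) = (q ^ 2 - 1) * q ^ 2 * (q ^ 4 - 1) := by
  have hq : 1 ≤ q := by have := h.two_le; omega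
  have h1 : 1 ≤ q ^ 4 := Nat.one_le_pow _ _ hq
  have h2 : q ^ 2 ≤ q ^ 4 := Nat.pow_le_pow_right hq (by norm_num)
  push_cast [h1, h2]
  ring

/-- The weight of a word of the code in terms of the alternating form that defines it. -/
theorem Represents.weight_mul {N : ℕ} {ω : Fin N → ⋀[F]^2 V} (e : Fin N ≃ isotropicLines η)
    (he : ∀ i, (pluecker 2 (e i).1).submodule = F ∙ ω i) {φ : Dual F (⋀[F]^2 V)} {f : V → V}
    (h : Represents q η (formOf φ) f) {n : ℕ} (hV : finrank F V = n + 4) :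
    ({i | φ (ω i) ≠ 0}.ncard : ℤ) * (q ^ 4 - 1) = weightSum η f q n := by
  have h1 := h.ncard_pairs_of_lines e {i | φ (ω i) ≠ 0} (activePairs η (formOf φ)) (by
    intro p
    constructor
    · rintro ⟨h1, h2, h3, h4⟩
      have hli := linearIndependent_of_form_ne_zero (formOf_self φ) h4
      exact ⟨⟨h1, h2, h3, hli⟩, fun i hi1 hi2 =>
        (eval_ne_zero_iff (he i) φ hi1 hi2 hli).2 h4⟩
    · rintro ⟨⟨h1, h2, h3, h4⟩, h5⟩
      refine ⟨h1, h2, h3, ?_⟩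
      obtain ⟨i, h7, h8⟩ := h.exists_line_of_pair e h1 h2 h3 h4
      exact (eval_ne_zero_iff (he i) φ h7 h8 h4).1 (h5 i h7 h8))
  have h2 := h.ncard_activePairs_eq hV
  rw [h1, Nat.cast_mul, h.cast_bases] at h2
  have hq : (2 : ℤ) ≤ q := by exact_mod_cast h.two_le
  have h3 : ((q : ℤ) ^ 2 - 1) * q ^ 2 ≠ 0 := mul_ne_zero (by nlinarith) (by positivity)
  refine mul_left_cancel₀ h3 ?_
  linear_combination h2

theorem IsHermitianSpace.minDist_pos (h : IsHermitianSpace q η) (n : ℕ) : 0 < minDist q n := by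
  have hq : (1 : ℤ) < q := by exact_mod_cast h.two_le
  rw [minDist]
  split_ifs with h1 h2
  · exact sub_pos.2 (pow_lt_pow_right₀ hq (by omega))
  · positivity
  · exact sub_pos.2 (pow_lt_pow_right₀ hq (by omega))

theorem IsHermitianSpace.pow_four_sub_one_pos (h : IsHermitianSpace q η) :
    (0 : ℤ) < q ^ 4 - 1 := by
  have hq : (1 : ℤ) < q := by exact_mod_cast h.two_le
  have : (1 : ℤ) < q ^ 4 := one_lt_pow₀ hq (by norm_num)
  linarith

variable {N : ℕ} {ω : Fin N → ⋀[F]^2 V} {n : ℕ}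

theorem minDist_le_weight (h : IsHermitianSpace q η)
    (hω : IsRepresentativeSystem (hermitianLineVariety η) ω) (hV : finrank F V = n + 4)
    {φ : Dual F (⋀[F]^2 V)} (hφ : φ ≠ 0) :
    minDist q n ≤ {i | φ (ω i) ≠ 0}.ncard := by
  obtain ⟨e, he⟩ := hω.exists_equiv
  obtain ⟨f, hf⟩ := h.exists_represents (formOf_self φ)
  have h1 := hf.weight_mul e he hV
  have h2 := hf.weightSum_ge hV (formOf_ne_zero hφ)
  rw [← h1] at h2
  exact le_of_mul_le_mul_right h2 h.pow_four_sub_one_pos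

theorem exists_weight_eq_minDist (h : IsHermitianSpace q η)
    (hω : IsRepresentativeSystem (hermitianLineVariety η) ω) (hV : finrank F V = n + 4) :
    ∃ φ : Dual F (⋀[F]^2 V), φ ≠ 0 ∧ ({i | φ (ω i) ≠ 0}.ncard : ℤ) = minDist q n := by
  obtain ⟨e, he⟩ := hω.exists_equiv
  obtain ⟨B, f, hf, hB, hle⟩ := h.exists_light_form hV
  obtain ⟨φ, rfl⟩ := exists_formOf_eq hf.alt
  have hφ : φ ≠ 0 := by
    rintro rfl
    exact hB (by ext; rfl)
  refine ⟨φ, hφ, le_antisymm ?_ (minDist_le_weight h hω hV hφ)⟩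
  rw [← hf.weight_mul e he hV] at hle
  exact le_of_mul_le_mul_right hle h.pow_four_sub_one_pos

/-- A nonzero functional gives a word of weight at least `minDist q n > 0`. This injectivity yields
the dimension of the code. -/
theorem eq_zero_of_word_eq_zero (h : IsHermitianSpace q η)
    (hω : IsRepresentativeSystem (hermitianLineVariety η) ω) (hV : finrank F V = n + 4)
    {φ : Dual F (⋀[F]^2 V)} (hφ : ∀ i, φ (ω i) = 0) : φ = 0 := by
  by_contra h0
  have h1 := minDist_le_weight h hω hV h0
  have h2 : {i | φ (ω i) ≠ 0} = ∅ := by ext i; simp [hφ]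
  rw [h2, Set.ncard_empty] at h1
  have := h.minDist_pos n
  push_cast at h1
  linarith

theorem finrank_code (h : IsHermitianSpace q η)
    (hω : IsRepresentativeSystem (hermitianLineVariety η) ω) (hV : finrank F V = n + 4) :
    finrank F (projectiveCode (F := F) ω) = (n + 4).choose 2 := by
  rw [projectiveCode, LinearMap.finrank_range_of_inj, Subspace.dual_finrank_eq,
    exteriorPower.finrank_eq, hV]
  rw [← LinearMap.ker_eq_bot, LinearMap.ker_eq_bot']
  intro φ hφ
  exact eq_zero_of_word_eq_zero h hω hV fun i => congrFun hφ i

theorem isMinimumDistance_code (h : IsHermitianSpace q η)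
    (hω : IsRepresentativeSystem (hermitianLineVariety η) ω) (hV : finrank F V = n + 4)
    [DecidableEq F] {d : ℕ} (hd : (d : ℤ) = minDist q n) :
    IsMinimumDistance (projectiveCode (F := F) ω) d := by
  have hdist : ∀ φ ψ : Dual F (⋀[F]^2 V),
      hammingDist (fun i => φ (ω i)) (fun i => ψ (ω i)) = {i | (φ - ψ) (ω i) ≠ 0}.ncard := by
    intro φ ψ
    rw [Set.ncard_eq_toFinset_card', hammingDist]
    congr 1
    ext i
    simp [sub_ne_zero]
  constructor
  · obtain ⟨φ, hφ, hw⟩ := exists_weight_eq_minDist h hω hV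
    refine ⟨_, ⟨φ, rfl⟩, _, ⟨0, rfl⟩, ?_, ?_⟩
    · intro h0
      refine hφ (eq_zero_of_word_eq_zero h hω hV fun i => ?_)
      exact congrFun h0 i
    · have h1 := hdist φ 0
      rw [sub_zero] at h1
      refine h1.trans ?_
      rw [← hd] at hw
      exact_mod_cast hw
  · rintro _ ⟨_, ⟨φ, rfl⟩, _, ⟨ψ, rfl⟩, hne, rfl⟩
    have h0 : φ - ψ ≠ 0 := fun h0 => hne (by rw [sub_eq_zero.1 h0])
    have h1 := minDist_le_weight h hω hV h0
    rw [← hdist, ← hd] at h1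
    exact_mod_cast h1

theorem card_lines_mul (h : IsHermitianSpace q η)
    (hω : IsRepresentativeSystem (hermitianLineVariety η) ω) (hV : finrank F V = n + 4) :
    (N : ℤ) * ((q ^ 2 - 1) * q ^ 2 * (q ^ 4 - 1)) =
      (q ^ (2 * n + 7) + (-1) ^ n * (q - 1) * q ^ (n + 3) - 1) *
      (q ^ (2 * n + 5) + (-1) ^ n * (q - 1) * q ^ (n + 3) - q ^ 2) := by
  obtain ⟨e, -⟩ := hω.exists_equiv
  have h1 := h.ncard_pairs_of_lines e Set.univ {p : V × V | η p.1 p.1 = 0 ∧ η p.2 p.2 = 0 ∧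
    η p.1 p.2 = 0 ∧ LinearIndependent F ![p.1, p.2]} (by simp)
  rw [← h.ncard_isotropic_pairs hV, h1, Nat.cast_mul, h.cast_bases, Set.ncard_univ, Nat.card_fin]

theorem card_lines_eq (h : IsHermitianSpace q η)
    (hω : IsRepresentativeSystem (hermitianLineVariety η) ω) (hV : finrank F V = n + 4) :
    (N : ℚ) = (((q : ℚ) ^ (n + 4) + (-1) ^ (n + 3)) * ((q : ℚ) ^ (n + 3) - (-1) ^ (n + 3)) *
        ((q : ℚ) ^ (n + 2) + (-1) ^ (n + 1)) * ((q : ℚ) ^ (n + 1) - (-1) ^ (n + 1))) /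
      (((q : ℚ) ^ 2 - 1) ^ 2 * ((q : ℚ) ^ 2 + 1)) := by
  have hq : (2 : ℚ) ≤ q := by exact_mod_cast h.two_le
  have h1 := card_lines_mul h hω hV
  have h2 : (N : ℚ) * ((q ^ 2 - 1) * q ^ 2 * (q ^ 4 - 1)) =
      (q ^ (2 * n + 7) + (-1) ^ n * (q - 1) * q ^ (n + 3) - 1) *
      (q ^ (2 * n + 5) + (-1) ^ n * (q - 1) * q ^ (n + 3) - q ^ 2) := by exact_mod_cast h1
  have h3 : (q : ℚ) ^ 2 - 1 ≠ 0 := by nlinarith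
  have h4 : (q : ℚ) ^ 2 + 1 ≠ 0 := by positivity
  have h5 : (q : ℚ) ^ 2 ≠ 0 := by positivity
  rw [eq_div_iff (mul_ne_zero (pow_ne_zero _ h3) h4)]
  refine mul_right_cancel₀ h5 ?_
  rcases neg_one_pow_eq_or ℚ n with h7 | h7
  · simp only [pow_succ (-1 : ℚ), h7] at h2 ⊢
    linear_combination h2
  · simp only [pow_succ (-1 : ℚ), h7] at h2 ⊢
    linear_combination h2

end Weights

end HermitianGrassmann

open HermitianGrassmann in
theorem mainTheorem1 {F V : Type*} [Field F] [Finite F] [DecidableEq F]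
    [AddCommGroup V] [Module F V] [FiniteDimensional F V]
    (q m : ℕ) (hF : Nat.card F = q ^ 2) (hV : Module.finrank F V = m) (hm : 4 ≤ m)
    -- `σ` is the involution `x ↦ x ^ q` of the field with `q ^ 2` elements
    (σ : F →+* F) (hσ : ∀ x, σ x = x ^ q)
    -- `η` is a non-degenerate Hermitian form
    (η : V →ₛₗ[σ] V →ₗ[F] F) (hη : η.IsSymm) (hnd : η.Nondegenerate)
    -- vector representatives of the points of the projective system, in any order
    (N : ℕ) (ω : Fin N → ⋀[F]^2 V)
    (hω : IsRepresentativeSystem (hermitianLineVariety η) ω) :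
    N = Nat.card (isotropicLines η) ∧
    (N : ℚ) =
      (((q : ℚ) ^ m + (-1) ^ (m - 1)) * ((q : ℚ) ^ (m - 1) - (-1) ^ (m - 1)) *
        ((q : ℚ) ^ (m - 2) + (-1) ^ (m - 3)) * ((q : ℚ) ^ (m - 3) - (-1) ^ (m - 3))) /
      (((q : ℚ) ^ 2 - 1) ^ 2 * ((q : ℚ) ^ 2 + 1)) ∧
    Module.finrank F (projectiveCode (F := F) ω) = m.choose 2 ∧
    (m = 4 ∨ m = 6 →
      IsMinimumDistance (projectiveCode (F := F) ω) (q ^ (4 * m - 12) - q ^ (2 * m - 6))) ∧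
    (8 ≤ m → Even m →
      IsMinimumDistance (projectiveCode (F := F) ω) (q ^ (4 * m - 12))) ∧
    (Odd m →
      IsMinimumDistance (projectiveCode (F := F) ω) (q ^ (4 * m - 12) - q ^ (3 * m - 9))) := by
  obtain ⟨n, rfl⟩ : ∃ n, m = n + 4 := ⟨m - 4, by omega⟩
  have : Finite V := Module.finite_of_finite F
  have h : IsHermitianSpace q η := ⟨hF, hσ, hη.eq, hnd.1⟩
  have hq : 1 ≤ q := by have := h.two_le; omega
  refine ⟨?_, ?_, finrank_code h hω hV, fun hn => ?_, fun h8 hn => ?_, fun hn => ?_⟩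
  · obtain ⟨e, -⟩ := hω.exists_equiv
    rw [← Nat.card_congr e, Nat.card_fin]
  · exact card_lines_eq h hω hV
  · refine isMinimumDistance_code h hω hV ?_
    rw [minDist, if_pos (by omega), Nat.cast_sub (Nat.pow_le_pow_right hq (by omega)),
      show 4 * (n + 4) - 12 = 4 * n + 4 by omega, show 2 * (n + 4) - 6 = 2 * n + 2 by omega]
    push_cast
    rfl
  · refine isMinimumDistance_code h hω hV ?_
    have hn' : Even n := by rw [Nat.even_iff] at hn ⊢; omega
    rw [minDist, if_neg (by omega), if_pos hn', show 4 * (n + 4) - 12 = 4 * n + 4 by omega]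
    push_cast
    rfl
  · refine isMinimumDistance_code h hω hV ?_
    have hn' : ¬ Even n := by rw [Nat.odd_iff] at hn; rw [Nat.even_iff]; omega
    rw [minDist, if_neg (by rw [Nat.odd_iff] at hn; omega), if_neg hn',
      Nat.cast_sub (Nat.pow_le_pow_right hq (by omega)),
      show 4 * (n + 4) - 12 = 4 * n + 4 by omega, show 3 * (n + 4) - 9 = 3 * n + 3 by omega]
    push_cast
    rfl
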